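/- **Setting.** Let $H$ be a self-adjoint operator on a finite-dimensional complex Hilbert space, $U^t=e^{-2\pi i Ht}$ for real $t\ge 0$, and let $\psi=\sum_{s=1}^S c_s\psi_s+r$ be a unit vector, where $S\ge 1$, $\psi_1,\dots,\psi_S$ are orthonormal, $H\psi_s=\lambda_s\psi_s$ with $\lambda_s\in[0,0.9]$, and the residual $r$ is orthogonal to all $\psi_s$. Suppose $|c_s|^2\ge\beta$ for all $s$ and $\|r\|^2\le\omega<\beta$. Put $\Lambda=\{\lambda_s\}_{s=1}^S$ and $B(T,\delta)=\bigcup_{t\in T}[t-\delta,t+\delta]$ for $T\subset\mathbb R$. **Parameters.** Let $\tau=\frac1\pi\log\frac{12}{\beta-\omega}$, $0<\alpha<\frac{\beta-\omega}3$, $0<\eta\le\frac1{8S(2S-1)}$, $0<\epsilon\le\eta$, $0<\rho<1$, let $K$ be an integer with $K\ge 3\eta^{-1}\tau$, and $$N_{HR}=2\left\lceil\frac4{\alpha^2}\left(\log\frac4\rho+\log\left(\left\lceil\log_2\frac\eta\epsilon\right\rceil+1\right)+\log(K+1)\right)\right\rceil .$$ **Algorithm.** Start with $E_{-1}=[0,0.9]$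 and $M_0=1$. Round $\ell=0,1,2,\dots$ does the following. 1. If $\ell\ge1$, put $M_\ell=M_{\ell-1}m_\ell$, where $m_\ell\in[2,4]$ is chosen, depending on all data measured so far in any way, such that $$\Bigl(B\bigl(E_{\ell-1},\tfrac{\eta}{2M_{\ell-1}}\bigr)+\tfrac q{M_{\ell-1}m_\ell}\Bigr)\cap E_{\ell-1}=\varnothing\quad\text{for all } q\in\mathbb Z\setminus\{0\}$$ (if no such number in $[2,4]$ exists, $m_\ell\in[2,4]$ is arbitrary). 2. For each $k=0,\dots,K$, run the one-ancilla Hadamard test of $U^{M_\ell k}$ on $\psi$ independently $N_{HR}/2$ times for the real part and $N_{HR}/2$ times for the imaginary part of $\langle\psi|U^{M_\ell k}|\psi\rangle$. Averaging the outcomes (counted as $\pm1$) gives $y_\ell(k)\in\mathbb C$; put $y_\ell(-k)=\overline{y_\ell(k)}$ for $k>0$. 3. With $\hat\phi(k)=e^{-\pi k^2\tau/K^2}$, form the $1$-periodic set $$X_\ell=\Bigl\{x\in\mathbb R:\Bigl|\sum_{|k|\le K}y_\ell(k)\hat\phi(k)e^{2\pi ikx}\Bigr|>\frac{6\beta+5\omega}{11}\sum_{k\in\mathbb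 Z}\hat\phi(k)\Bigr\},$$ and let $Y_\ell$ be the union of the closures of the intervals of $X_\ell$ and of all gaps between them of length less than $\tau/K$. 4. For each interval (connected component) $I'$ of $\frac1{M_\ell}Y_\ell$, taken modulo $\frac1{M_\ell}$, find the integer $q$ with $(I'+\frac q{M_\ell})\cap E_{\ell-1}\neq\varnothing$; let $E_\ell$ be the union of these sets $I'+\frac q{M_\ell}$ (if $q$ is not unique, all of them are taken). 5. Stop with $L=\ell$ and output $E_L$ if $\eta/M_\ell\le\epsilon$; otherwise go on with round $\ell+1$. Let $T_{\max}$ and $T_{\rm total}$ be the maximum and the sum of the evolution times $M_\ell k$ over all executed circuits. **Theorem.** There is an absolute constant $C>0$ such that, in every such situation and for every such choice of the factors $m_\ell$: * the algorithm always stops after at most $\lceil\log_2\frac\eta\epsilon\rceil+1$ rounds, and always $$T_{\max}\le C\,\frac{\eta K}{\epsilon},\qquad T_{\rm total}\le C\,\frac{\eta K^2N_{HR}}{\epsilon};$$ * with probability at least $1-\rho$, every factor $m_\ell$ satisfies the condition in step 1, every integer $q$ in step 4 exists and is unique, and $\Lambda\subset E_L\subset B(\Lambda,\epsilon)$. -/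

import Mathlib

open Set
open scoped ENNReal

noncomputable section

/-! ### Hadamard tests -/

section Circuit

variable {E : Type*} [NormedAddCommGroup E] [InnerProductSpace ℂ E]

/-- The Hadamard gate on the ancilla.  A state of ancilla and system register is written as the pair
`s 0, s 1` of its components along the ancilla states `|0⟩` and `|1⟩`. -/
def ancillaHadamard (s : Fin 2 → E) : Fin 2 → E :=
  ![(1 / Real.sqrt 2 : ℝ) • (s 0 + s 1), (1 / Real.sqrt 2 : ℝ) • (s 0 - s 1)]

/-- The application of `U` to the system register, controlled by the ancilla. -/
def controlled (U : E →L[ℂ] E) (s : Fin 2 → E) : Fin 2 → E := ![s 0, U (s 1)]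

/-- The diagonal gate `diag(1, w)` on the ancilla. -/
def ancillaPhase (w : ℂ) (s : Fin 2 → E) : Fin 2 → E := ![s 0, w • s 1]

/-- The gate between the controlled operation and the last Hadamard gate: the identity (for the
real part, index `0`) or the adjoint of the phase gate (for the imaginary part, index `1`). -/
def partPhase : Fin 2 → ℂ := ![1, -Complex.I]

/-- The final state of the Hadamard test of `U` on the input `|0⟩ ⊗ ψ`. -/
def hadamardState (U : E →L[ℂ] E) (ψ : E) (part : Fin 2) : Fin 2 → E :=
  ancillaHadamard (ancillaPhase (partPhase part) (controlled U (ancillaHadamard ![ψ, 0])))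

theorem norm_sq_ancillaHadamard (s : Fin 2 → E) :
    ‖ancillaHadamard s 0‖ ^ 2 + ‖ancillaHadamard s 1‖ ^ 2 = ‖s 0‖ ^ 2 + ‖s 1‖ ^ 2 := by
  have h2 : (1 / Real.sqrt 2) ^ 2 = (1 / 2 : ℝ) := by
    rw [div_pow, Real.sq_sqrt (by norm_num)]; norm_num
  have hp := parallelogram_law_with_norm ℂ (s 0) (s 1)
  simp only [ancillaHadamard, Matrix.cons_val_zero, Matrix.cons_val_one, norm_smul, mul_pow,
    Real.norm_eq_abs, sq_abs, h2]
  nlinarith [hp]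

theorem norm_partPhase (part : Fin 2) : ‖partPhase part‖ = 1 := by
  fin_cases part <;> simp [partPhase]

theorem norm_sq_hadamardState (U : E →L[ℂ] E) (hU : ∀ x, ‖U x‖ = ‖x‖) (ψ : E)
    (part : Fin 2) :
    ‖hadamardState U ψ part 0‖ ^ 2 + ‖hadamardState U ψ part 1‖ ^ 2 = ‖ψ‖ ^ 2 := by
  have h1 := norm_sq_ancillaHadamard (![ψ, 0] : Fin 2 → E)
  rw [hadamardState, norm_sq_ancillaHadamard]
  simp only [ancillaPhase, controlled, Matrix.cons_val_zero, Matrix.cons_val_one, norm_smul,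
    norm_partPhase, one_mul, hU]
  simpa using h1

variable [CompleteSpace E]

/-- The real power `U ^ t = exp (-2πi H t)`. -/
def evolution (H : selfAdjoint (E →L[ℂ] E)) (t : ℝ) : E →L[ℂ] E :=
  NormedSpace.exp ((-(2 * Real.pi * t : ℝ) * Complex.I : ℂ) • (H : E →L[ℂ] E))

theorem norm_evolution (H : selfAdjoint (E →L[ℂ] E)) (t : ℝ) (x : E) :
    ‖evolution H t x‖ = ‖x‖ := by
  let a : selfAdjoint (E →L[ℂ] E) := (-(2 * Real.pi * t)) • H
  have h : evolution H t = (selfAdjoint.expUnitary a : E →L[ℂ] E) := by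
    rw [selfAdjoint.expUnitary_coe, evolution]
    congr 1
    ext y
    simp only [a, selfAdjoint.val_smul, smul_apply]
    rw [← Complex.coe_smul (-(2 * Real.pi * t)), smul_smul]
    push_cast
    ring_nf
  rw [h]
  exact ContinuousLinearMap.norm_map_of_mem_unitary (selfAdjoint.expUnitary a).2 x

/-- The law of the measured ancilla bit in the Hadamard test of `exp (-2πi H t)` (Born rule). -/
def hadamardTest (H : selfAdjoint (E →L[ℂ] E)) (ψ : Metric.sphere (0 : E) 1) (t : ℝ)
    (part : Fin 2) : PMF (Fin 2) :=
  PMF.ofFintype (fun b => ENNReal.ofReal (‖hadamardState (evolution H t) (ψ : E) part b‖ ^ 2)) (by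
    rw [Fin.sum_univ_two, ← ENNReal.ofReal_add (by positivity) (by positivity),
      norm_sq_hadamardState _ (norm_evolution H t)]
    simp)

end Circuit

/-- The joint law of finitely many independent random variables with laws `p i`. -/
def independentLaw {ι κ : Type*} [Fintype ι] [DecidableEq ι] [Fintype κ] (p : ι → PMF κ) :
    PMF (ι → κ) :=
  PMF.ofFintype (fun d => ∏ i, p i (d i)) (by
    rw [← Fintype.prod_sum (fun i j => p i j)]
    refine Finset.prod_eq_one fun i _ => ?_
    rw [← tsum_fintype (L := .unconditional _)]
    exact (p i).tsum_coe)

/-! ### Data of one round -/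

/-- The executions of one round: a frequency `k ∈ {0, …, K}`, the real (`0`) or imaginary (`1`) part,
and one of the `N / 2` repetitions. -/
abbrev TestIndex (K N : ℕ) : Type := Fin (K + 1) × Fin 2 × Fin (N / 2)

/-- The measured bits of one round. -/
abbrev RoundData (K N : ℕ) : Type := TestIndex K N → Fin 2

/-- One round at amplification `M`: independent Hadamard tests of `U ^ (M k)`. -/
def roundLaw {E : Type*} [NormedAddCommGroup E] [InnerProductSpace ℂ E] [CompleteSpace E]
    (H : selfAdjoint (E →L[ℂ] E)) (ψ : Metric.sphere (0 : E) 1) (K N : ℕ) (M : ℝ) :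
    PMF (RoundData K N) :=
  independentLaw fun i => hadamardTest H ψ (M * (i.1 : ℕ)) i.2.1

/-- The average over the repetitions, the bits `0` and `1` being counted as `+1` and `-1`. -/
def averagedPart {K N : ℕ} (d : RoundData K N) (k : Fin (K + 1)) (part : Fin 2) : ℝ :=
  (∑ j, (-1 : ℝ) ^ (d (k, part, j) : ℕ)) / (N / 2 : ℕ)

/-- The averaged measurements `y(k)` for `0 ≤ k ≤ K`. -/
def averagedSignal {K N : ℕ} (d : RoundData K N) (k : Fin (K + 1)) : ℂ :=
  averagedPart d k 0 + averagedPart d k 1 * Complex.I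

/-- The signal `y(k)` for `|k| ≤ K`, with `y(-k)` the complex conjugate of `y(k)` for `k > 0`. -/
def signal {K N : ℕ} (d : RoundData K N) (k : ℤ) : ℂ :=
  if 0 ≤ k then averagedSignal d (Fin.ofNat (K + 1) k.natAbs)
  else (starRingEnd ℂ) (averagedSignal d (Fin.ofNat (K + 1) k.natAbs))

/-! ### Signal processing -/

/-- `τ = (1/π) log (12 / (β - ω))`. -/
def tau (β ω : ℝ) : ℝ := 1 / Real.pi * Real.log (12 / (β - ω))

/-- The Gaussian weights `exp (-π (k σ / K)²)` with `σ = √τ`. -/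
def gaussianWeight (β ω : ℝ) (K : ℕ) (k : ℤ) : ℝ :=
  Real.exp (-Real.pi * (k * Real.sqrt (tau β ω) / K) ^ 2)

/-- The superlevel set `X` of the Gaussian-filtered signal, as a `1`-periodic subset of `ℝ`. -/
def superlevelSet (β ω : ℝ) {K N : ℕ} (d : RoundData K N) : Set ℝ :=
  {x | (6 * β + 5 * ω) / 11 * (∑' k : ℤ, gaussianWeight β ω K k) <
    ‖∑ k ∈ Finset.Icc (-(K : ℤ)) K, signal d k * gaussianWeight β ω K k *
      Complex.exp (2 * Real.pi * Complex.I * k * x)‖}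

/-- The set `Y` (as a `1`-periodic subset of `ℝ`): the union of the closures of the intervals of `X`
and of all the gaps of length less than `τ / K` between them. -/
def filledSet (β ω : ℝ) {K N : ℕ} (d : RoundData K N) : Set ℝ :=
  closure (superlevelSet β ω d) ∪
    {x | ∃ a ∈ closure (superlevelSet β ω d), ∃ b ∈ closure (superlevelSet β ω d),
      a ≤ x ∧ x ≤ b ∧ b - a < tau β ω / K}

/-! ### The adaptive algorithm -/

/-- `B(T, r) = ⋃_{t ∈ T} [t - r, t + r]`. -/
def nbhd (T : Set ℝ) (r : ℝ) : Set ℝ := ⋃ t ∈ T, Icc (t - r) (t + r)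

/-- The translate `T + a`. -/
def translateSet (T : Set ℝ) (a : ℝ) : Set ℝ := (fun t => t + a) '' T

/-- The intervals (connected components) of `M⁻¹ Y`, for a periodic set `Y ⊆ ℝ` of period `1`.  Thus
two intervals that differ by a multiple of `1 / M` represent the same interval modulo `1 / M`. -/
def scaledIntervals (Y : Set ℝ) (M : ℝ) : Set (Set ℝ) :=
  {J | ∃ x ∈ {x : ℝ | M * x ∈ Y}, J = connectedComponentIn {x : ℝ | M * x ∈ Y} x}

/-- The next estimate: the union of the intervals `J + q / M`, where `J` is an interval of `M⁻¹ Y` and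
`q` an integer for which `J + q / M` meets the current estimate `F`. -/
def updateEstimate (Y : Set ℝ) (M : ℝ) (F : Set ℝ) : Set ℝ :=
  {x | ∃ J ∈ scaledIntervals Y M, ∃ q : ℤ,
    (translateSet J (q / M) ∩ F).Nonempty ∧ x ∈ translateSet J (q / M)}

/-- The shift `q` exists and is unique, for every interval of `M⁻¹ Y`. -/
def UniqueShifts (Y : Set ℝ) (M : ℝ) (F : Set ℝ) : Prop :=
  ∀ J ∈ scaledIntervals Y M, ∃! q : ℤ, (translateSet J (q / M) ∩ F).Nonempty

/-- The requirement on the factor `m`, given the previous amplification `M` and estimate `F`: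
`(B(F, η / (2M)) + q / (M m)) ∩ F = ∅` for all nonzero integers `q`. -/
def Separates (η M : ℝ) (F : Set ℝ) (m : ℝ) : Prop :=
  ∀ q : ℤ, q ≠ 0 → translateSet (nbhd F (η / (2 * M))) (q / (M * m)) ∩ F = ∅

/-- The data of all completed rounds, the most recent round first. -/
abbrev History (K N : ℕ) : Type := List (RoundData K N)

section Algorithm

variable {K N : ℕ}

/-- The amplification `M_ℓ` used in round `ℓ`, as a function of the data of the rounds `0, …, ℓ - 1`:
`M_0 = 1` and `M_ℓ = M_{ℓ-1} m_ℓ`, where `m_ℓ` is chosen by `rule` from the data collected so far. -/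
def amplification (rule : History K N → ℝ) : History K N → ℝ
  | [] => 1
  | d :: h => amplification rule h * rule (d :: h)

/-- The estimate after the completed rounds, starting from `[0, 0.9]`. -/
def estimate (β ω : ℝ) (rule : History K N → ℝ) : History K N → Set ℝ
  | [] => Icc 0 (9 / 10)
  | d :: h => updateEstimate (filledSet β ω d) (amplification rule h) (estimate β ω rule h)

/-- A rule for the factors: it selects a number in `[2, 4]`, and one that satisfies the separation
requirement whenever there is one. -/
def AdmissibleRule (β ω η : ℝ) (rule : History K N → ℝ) : Prop :=
  ∀ (d : RoundData K N) (h : History K N), rule (d :: h) ∈ Icc (2 : ℝ) 4 ∧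
    ((∃ m ∈ Icc (2 : ℝ) 4,
        Separates η (amplification rule h) (estimate β ω rule (d :: h)) m) →
      Separates η (amplification rule h) (estimate β ω rule (d :: h)) (rule (d :: h)))

/-- The loop ends after the first round `ℓ` with `η / M_ℓ ≤ ε`. -/
def Halted (η ε : ℝ) (rule : History K N → ℝ) : History K N → Prop
  | [] => False
  | _ :: h => η / amplification rule h ≤ ε

/-- The factor chosen after the rounds of a history satisfies the separation requirement (there is
nothing to choose before round `0`). -/
def FactorSeparates (β ω η : ℝ) (rule : History K N → ℝ) : History K N → Prop
  | [] => True
  | d :: h => Separates η (amplification rule h) (estimate β ω rule (d :: h)) (rule (d :: h))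

/-- In every completed round, the factor met its requirement and all shifts existed and were
unique, so that every instruction of the algorithm could be carried out. -/
def ProperRun (β ω η : ℝ) (rule : History K N → ℝ) : History K N → Prop
  | [] => True
  | d :: h => ProperRun β ω η rule h ∧ FactorSeparates β ω η rule h ∧
      UniqueShifts (filledSet β ω d) (amplification rule h) (estimate β ω rule h)

/-- The maximal evolution time of the executed circuits. -/
def maxRuntime (rule : History K N → ℝ) : History K N → ℝ
  | [] => 0
  | _ :: h => max (maxRuntime rule h)
      (⨆ i : TestIndex K N, amplification rule h * (i.1 : ℕ))

/-- The sum of the evolution times over all executed circuits. -/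
def totalRuntime (rule : History K N → ℝ) : History K N → ℝ
  | [] => 0
  | _ :: h => totalRuntime rule h +
      ∑ i : TestIndex K N, amplification rule h * (i.1 : ℕ)

variable {E : Type*} [NormedAddCommGroup E] [InnerProductSpace ℂ E] [CompleteSpace E]

open Classical in
/-- One pass through the loop. -/
def loopStep (H : selfAdjoint (E →L[ℂ] E)) (ψ : Metric.sphere (0 : E) 1) (η ε : ℝ)
    (rule : History K N → ℝ) (h : History K N) : PMF (History K N) :=
  if Halted η ε rule h then PMF.pure h
  else (roundLaw H ψ K N (amplification rule h)).map (fun d => d :: h)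

/-- The law of the history after at most `n` rounds. -/
def runLaw (H : selfAdjoint (E →L[ℂ] E)) (ψ : Metric.sphere (0 : E) 1) (η ε : ℝ)
    (rule : History K N → ℝ) : ℕ → PMF (History K N)
  | 0 => PMF.pure []
  | n + 1 => (runLaw H ψ η ε rule n).bind (loopStep H ψ η ε rule)

end Algorithm

end

noncomputable section

/-! ### Periodized Gaussians -/

/-! Expanding the residual in an eigenbasis of `H`, the exact signal `⟨ψ, U^(Mk) ψ⟩` is the Fourier
transform of a positive measure of total mass 1: atoms of weight at least `β` at the points `M λ_s`,
plus a residual of mass at most `ω` (`inner_evolution_eq`). Gaussian weights convolve it with a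
periodized Gaussian, which by Poisson summation is nonnegative, maximal at the integers, and small
at distance `τ / K` from them. Relative to the filter's maximum, truncation costs `(β - ω) / 12` and
noise at most `α < (β - ω) / 3`. The threshold `(6β + 5ω) / 11` is therefore exceeded at every `M
λ_s + n` and not reached at distance at least `τ / K` from all of them (`lt_norm_filteredSignal`,
`norm_filteredSignal_lt`).

Filling short gaps makes every interval contain some `M λ_s + n` and keeps it within `3τ / (2K) ≤ η
/ 2` of such points. After division by `M` the aliases under shifts by `1 / M` must be told apart.
The separation condition on `m` does this (`uniqueShifts_and_updateEstimate`). A suitable `m` exists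
because, in terms of `u = 1 / m`, each of the `S(S-1)/2` pairs of frequencies spoils a set of
measure at most `6η`, too little to fill `[1/4, 1/2]` (`exists_separates`). The statement that the
estimate contains all `λ_s` and lies within `η / (2M)` of them thus propagates from round to round
(`properRun_of_accurateHistory`).

The probability enters only through the event that all averages are accurate. Hoeffding's inequality
and a union bound control one round uniformly in `M`, so adaptive choices do no harm
(`runLaw_toOuterMeasure_le`). The running times follow from `M` growing by a factor in `[2, 4]`: the
last `M` is at most `4η / ε`, and the sum over rounds is geometric. -/

/-- The value at `x` of the function whose `k`-th Fourier coefficient is `exp (-π b k²)`. -/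
def thetaKernel (b x : ℝ) : ℝ :=
  1 / Real.sqrt b * ∑' n : ℤ, Real.exp (-Real.pi / b * ((n : ℝ) - x) ^ 2)

theorem summable_exp_neg_mul_int_sq {b : ℝ} (hb : 0 < b) :
    Summable fun k : ℤ => Real.exp (-Real.pi * b * (k : ℝ) ^ 2) := by
  have h := summable_pow_mul_jacobiTheta₂_term_bound 0 hb 0
  simpa [mul_comm, mul_assoc, mul_left_comm] using h

theorem summable_exp_neg_mul_int_sub_sq {b : ℝ} (hb : 0 < b) (x : ℝ) :
    Summable fun n : ℤ => Real.exp (-Real.pi / b * ((n : ℝ) - x) ^ 2) := by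
  have h := (summable_pow_mul_jacobiTheta₂_term_bound (|x| / b) (T := 1 / b) (by positivity) 0)
  refine Summable.of_nonneg_of_le (fun _ => (Real.exp_pos _).le) (fun n => ?_) h
  rw [pow_zero, one_mul, Real.exp_le_exp]
  have h1 : (n : ℝ) * x ≤ |(n : ℝ)| * |x| := by rw [← abs_mul]; exact le_abs_self _
  have h2 : ((n : ℝ) - x) ^ 2 ≥ n ^ 2 - 2 * (|(n : ℝ)| * |x|) := by nlinarith [sq_nonneg x]
  have h3 : 0 ≤ Real.pi / b := by positivity
  have h4 := mul_le_mul_of_nonneg_left h2 h3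
  push_cast
  calc -Real.pi / b * ((n : ℝ) - x) ^ 2 = -(Real.pi / b * ((n : ℝ) - x) ^ 2) := by ring
    _ ≤ -(Real.pi / b * (n ^ 2 - 2 * (|(n : ℝ)| * |x|))) := by linarith
    _ = _ := by ring

/-- Poisson summation for the Gaussian; the imaginary linear term `I * x` becomes the real shift by
`x` on the dual side. -/
theorem hasSum_thetaKernel {b : ℝ} (hb : 0 < b) (x : ℝ) :
    HasSum (fun k : ℤ => (Real.exp (-Real.pi * b * (k : ℝ) ^ 2) : ℂ) *
      Complex.exp (2 * Real.pi * Complex.I * k * x)) (thetaKernel b x : ℂ) := by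
  have hs : Summable fun k : ℤ => (Real.exp (-Real.pi * b * (k : ℝ) ^ 2) : ℂ) *
      Complex.exp (2 * Real.pi * Complex.I * k * x) := by
    refine Summable.of_norm_bounded (summable_exp_neg_mul_int_sq hb) (fun k => ?_)
    rw [norm_mul, Complex.norm_real, Real.norm_eq_abs, Real.abs_exp, Complex.norm_exp]
    simp
  convert hs.hasSum using 1
  have h := Complex.tsum_exp_neg_quadratic (a := (b : ℂ)) (by simpa using hb) (Complex.I * x)
  have e : (fun k : ℤ => (Real.exp (-Real.pi * b * (k : ℝ) ^ 2) : ℂ) *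
      Complex.exp (2 * Real.pi * Complex.I * k * x)) = fun n : ℤ =>
      Complex.exp (-Real.pi * b * n ^ 2 + 2 * Real.pi * (Complex.I * x) * n) := by
    funext k
    rw [Complex.ofReal_exp, ← Complex.exp_add]
    congr 1
    push_cast
    ring
  rw [e, h, thetaKernel]
  push_cast
  congr 1
  · rw [Real.sqrt_eq_rpow, Complex.ofReal_cpow hb.le]; norm_num
  · refine tsum_congr fun n => ?_
    congr 1
    rw [← mul_assoc, Complex.I_mul_I]
    ring

theorem thetaKernel_nonneg (b x : ℝ) : 0 ≤ thetaKernel b x :=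
  mul_nonneg (by positivity) (tsum_nonneg fun _ => (Real.exp_pos _).le)

theorem thetaKernel_int {b : ℝ} (hb : 0 < b) (n : ℤ) :
    thetaKernel b n = ∑' k : ℤ, Real.exp (-Real.pi * b * (k : ℝ) ^ 2) := by
  have h := hasSum_thetaKernel hb n
  have h2 := Complex.hasSum_ofReal.mpr (summable_exp_neg_mul_int_sq hb).hasSum
  have e : (fun k : ℤ => (Real.exp (-Real.pi * b * (k : ℝ) ^ 2) : ℂ) *
      Complex.exp (2 * Real.pi * Complex.I * k * (n : ℝ))) =
      fun k : ℤ => (Real.exp (-Real.pi * b * (k : ℝ) ^ 2) : ℂ) := by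
    funext k
    have : (2 * Real.pi * Complex.I * k * (n : ℝ) : ℂ) = ((k * n : ℤ) : ℂ) * (2 * Real.pi * Complex.I) := by
      push_cast; ring
    rw [this, Complex.exp_int_mul_two_pi_mul_I, mul_one]
  rw [e] at h
  exact_mod_cast h.unique h2

theorem thetaKernel_le {b : ℝ} (hb : 0 < b) (x : ℝ) :
    thetaKernel b x ≤ ∑' k : ℤ, Real.exp (-Real.pi * b * (k : ℝ) ^ 2) := by
  have h := hasSum_thetaKernel hb x
  have hn : ‖(thetaKernel b x : ℂ)‖ ≤ ∑' k : ℤ, Real.exp (-Real.pi * b * (k : ℝ) ^ 2) := by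
    rw [← h.tsum_eq]
    refine tsum_of_norm_bounded (summable_exp_neg_mul_int_sq hb).hasSum (fun k => ?_)
    rw [norm_mul, Complex.norm_real, Real.norm_eq_abs, Real.abs_exp, Complex.norm_exp]
    simp
  rw [Complex.norm_real, Real.norm_eq_abs] at hn
  exact (le_abs_self _).trans hn

/-- The summand `n = 0` of the dual series at `x = 0` already gives this. It turns absolute bounds
on the kernel into bounds relative to its maximum. -/
theorem one_div_sqrt_le_tsum_exp {b : ℝ} (hb : 0 < b) :
    1 / Real.sqrt b ≤ ∑' k : ℤ, Real.exp (-Real.pi * b * (k : ℝ) ^ 2) := by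
  rw [← thetaKernel_int hb 0, thetaKernel]
  refine le_mul_of_one_le_right (by positivity) ?_
  have := (summable_exp_neg_mul_int_sub_sq hb 0).le_tsum 0 (fun _ _ => (Real.exp_pos _).le)
  simpa using this

theorem hasSum_pow_natAbs {q : ℝ} (h0 : 0 ≤ q) (h1 : q < 1) :
    HasSum (fun m : ℤ => q ^ m.natAbs) ((1 + q) / (1 - q)) := by
  have h := hasSum_geometric_of_lt_one h0 h1
  have h2 : HasSum (fun n : ℕ => q ^ (n + 1)) (q * (1 - q)⁻¹) := by
    simpa [pow_succ'] using h.mul_left q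
  have h3 := HasSum.of_nat_of_neg_add_one (f := fun m : ℤ => q ^ m.natAbs) (by simpa using h)
    (m' := q * (1 - q)⁻¹) (by
      convert h2 using 2 with n
      congr 1)
  convert h3 using 1
  have : (1 - q) ≠ 0 := by linarith
  field_simp

/-- Away from the integers the periodized Gaussian is at most its nearest summand plus a geometric
series. -/
theorem tsum_exp_neg_le_of_forall_le {b δ x : ℝ} (hb : 0 < b) (hδ : 0 ≤ δ)
    (hx : ∀ n : ℤ, δ ≤ |(n : ℝ) - x|) :
    ∑' n : ℤ, Real.exp (-Real.pi / b * ((n : ℝ) - x) ^ 2) ≤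
      Real.exp (-Real.pi / b * δ ^ 2) + 2 * Real.exp (-Real.pi / b / 4) /
        (1 - Real.exp (-Real.pi / b / 4)) := by
  set q := Real.exp (-Real.pi / b / 4) with hq
  have hpb : 0 < Real.pi / b := by positivity
  have hq1 : q < 1 := by
    rw [hq, Real.exp_lt_one_iff]
    have : -Real.pi / b / 4 = -(Real.pi / b / 4) := by ring
    rw [this]; linarith
  have hgeo : HasSum (fun m : ℤ => q ^ m.natAbs) ((1 + q) / (1 - q)) :=
    hasSum_pow_natAbs (Real.exp_pos _).le hq1
  -- Corrects the central term of the geometric series from `1` to the Gaussian at distance `δ`.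
  have hsing : HasSum (fun m : ℤ => if m = 0 then Real.exp (-Real.pi / b * δ ^ 2) - 1 else 0)
      (Real.exp (-Real.pi / b * δ ^ 2) - 1) := hasSum_ite_eq 0 _
  have hsum := hgeo.add hsing
  have hs := summable_exp_neg_mul_int_sub_sq hb x
  rw [← (Equiv.addRight (round x)).tsum_eq]
  have hs' := (Equiv.addRight (round x)).summable_iff.mpr hs
  have := hs'.tsum_le_tsum (fun m => ?_) hsum.summable
  · refine this.trans (le_of_eq ?_)
    rw [hsum.tsum_eq]
    have h0 : 1 - q ≠ 0 := by linarith
    have h1 : (1 + q) / (1 - q) = 1 + 2 * q / (1 - q) := by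
      rw [eq_comm, eq_div_iff h0, add_mul, div_mul_cancel₀ _ h0]
      ring
    rw [h1]
    ring
  · have key : ∀ y z : ℝ, y ≤ z → Real.exp (-Real.pi / b * z) ≤ Real.exp (-Real.pi / b * y) := by
      intro y z hyz
      rw [Real.exp_le_exp, neg_div, neg_mul, neg_mul, neg_le_neg_iff]
      exact mul_le_mul_of_nonneg_left hyz hpb.le
    by_cases hm : m = 0
    · subst hm
      simp only [Function.comp, Equiv.coe_addRight, zero_add, Int.natAbs_zero, pow_zero, if_true,
        add_sub_cancel]
      apply key
      rw [← sq_abs ((round x : ℝ) - x)]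
      exact pow_le_pow_left₀ hδ (hx _) 2
    · simp only [Function.comp, Equiv.coe_addRight, if_neg hm, add_zero]
      rw [hq, ← Real.exp_nat_mul]
      have e : (m.natAbs : ℝ) * (-Real.pi / b / 4) = -Real.pi / b * (m.natAbs / 4) := by ring
      rw [e]
      apply key
      have h1 : (1 : ℝ) ≤ m.natAbs := by exact_mod_cast Nat.one_le_iff_ne_zero.mpr (by simpa using hm)
      have h2 : |x - round x| ≤ 1 / 2 := abs_sub_round x
      have h3 : (m.natAbs : ℝ) = |(m : ℝ)| := by simp [Nat.cast_natAbs]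
      rw [h3] at h1 ⊢
      have h4 : |(m : ℝ)| - 1 / 2 ≤ |((m + round x : ℤ) : ℝ) - x| := by
        have := abs_sub_abs_le_abs_sub (m : ℝ) (x - round x)
        push_cast
        have e2 : (m : ℝ) + round x - x = m - (x - round x) := by ring
        rw [e2]; linarith
      rw [← sq_abs (((m + round x : ℤ) : ℝ) - x)]
      -- For `|m| ≥ 1` one has `(|m| - 1/2)² ≥ |m| / 4`, which is where the ratio `exp (-π / (4b))`
      -- comes from.
      have h5 := pow_le_pow_left₀ (by linarith) h4 2
      nlinarith

end

noncomputable section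

/-! ### The filtered signal -/

theorem tau_pos {β ω : ℝ} (h : ω < β) (h1 : β - ω ≤ 1) : 0 < tau β ω := by
  refine mul_pos (by positivity) (Real.log_pos ?_)
  rw [lt_div_iff₀ (by linarith)]
  linarith

/-- This identity is the reason for the choice of `τ`: the same number bounds the kernel's main
summand at distance `τ / K` and the weights beyond `|k| = K`. -/
theorem exp_neg_pi_mul_tau {β ω : ℝ} (h : ω < β) :
    Real.exp (-Real.pi * tau β ω) = (β - ω) / 12 := by
  have h0 : 0 < β - ω := by linarith
  have : -Real.pi * tau β ω = -Real.log (12 / (β - ω)) := by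
    rw [tau]
    field_simp
  rw [this, Real.exp_neg, Real.exp_log (by positivity), inv_div]

theorem gaussianWeight_eq {β ω : ℝ} (hτ : 0 ≤ tau β ω) (K : ℕ) (k : ℤ) :
    gaussianWeight β ω K k = Real.exp (-Real.pi * (tau β ω / (K : ℝ) ^ 2) * (k : ℝ) ^ 2) := by
  rw [gaussianWeight]
  congr 1
  rw [div_pow, mul_pow, Real.sq_sqrt hτ]
  ring

theorem gaussianWeight_pos (β ω : ℝ) (K : ℕ) (k : ℤ) : 0 < gaussianWeight β ω K k :=
  Real.exp_pos _

theorem summable_gaussianWeight {β ω : ℝ} {K : ℕ} (hτ : 0 < tau β ω) (hK : 0 < K) :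
    Summable (gaussianWeight β ω K) := by
  have : gaussianWeight β ω K = _ := funext (gaussianWeight_eq hτ.le K)
  rw [this]
  exact summable_exp_neg_mul_int_sq (by positivity)

/-- The value at `0` of the untruncated filter. -/
def filterMass (β ω : ℝ) (K : ℕ) : ℝ := ∑' k : ℤ, gaussianWeight β ω K k

/-- The untruncated filter, the sum of `φ̂(k) exp (2πikx)` over all integers `k`. -/
def filterKernel (β ω : ℝ) (K : ℕ) (x : ℝ) : ℝ := thetaKernel (tau β ω / (K : ℝ) ^ 2) x

section Filter

variable {β ω : ℝ} {K : ℕ}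

theorem filterMass_eq (hτ : 0 ≤ tau β ω) :
    filterMass β ω K = ∑' k : ℤ, Real.exp (-Real.pi * (tau β ω / (K : ℝ) ^ 2) * (k : ℝ) ^ 2) :=
  tsum_congr (gaussianWeight_eq hτ K)

theorem filterMass_pos (hτ : 0 < tau β ω) (hK : 0 < K) : 0 < filterMass β ω K :=
  (summable_gaussianWeight hτ hK).tsum_pos (fun k => (gaussianWeight_pos _ _ _ k).le) 0
    (gaussianWeight_pos _ _ _ 0)

theorem filterKernel_nonneg (x : ℝ) : 0 ≤ filterKernel β ω K x := thetaKernel_nonneg _ _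

theorem filterKernel_int (hτ : 0 < tau β ω) (hK : 0 < K) (n : ℤ) :
    filterKernel β ω K n = filterMass β ω K := by
  rw [filterMass_eq hτ.le, filterKernel, thetaKernel_int (by positivity)]

theorem filterKernel_le (hτ : 0 < tau β ω) (hK : 0 < K) (x : ℝ) :
    filterKernel β ω K x ≤ filterMass β ω K := by
  rw [filterMass_eq hτ.le]
  exact thetaKernel_le (by positivity) x

theorem hasSum_filterKernel (hτ : 0 < tau β ω) (hK : 0 < K) (x : ℝ) :
    HasSum (fun k : ℤ => (gaussianWeight β ω K k : ℂ) *
      Complex.exp (2 * Real.pi * Complex.I * k * x)) (filterKernel β ω K x : ℂ) := by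
  simp only [gaussianWeight_eq hτ.le]
  exact hasSum_thetaKernel (by positivity) x

/-- With `P = (β - ω) / 12`, the nearest summand gives `P` and all others together at most `6/11 *
P`, whence `17/11`. -/
theorem filterKernel_le_of_forall_le (h : ω < β) (h1 : β - ω ≤ 1) (hK : 3 * tau β ω ≤ K)
    {x : ℝ} (hx : ∀ n : ℤ, tau β ω / K ≤ |x - n|) :
    filterKernel β ω K x ≤ 17 / 11 * ((β - ω) / 12) * filterMass β ω K := by
  have hτ := tau_pos h h1
  have hK0 : (0 : ℝ) < K := by linarith
  have hb : 0 < tau β ω / (K : ℝ) ^ 2 := by positivity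
  have hP := exp_neg_pi_mul_tau h
  set P := (β - ω) / 12 with hPdef
  have hP0 : 0 < P := by rw [hPdef]; linarith
  have hP1 : P ≤ 1 / 12 := by rw [hPdef]; linarith
  have hsum := tsum_exp_neg_le_of_forall_le hb (δ := tau β ω / K) (x := x) (by positivity)
    (fun n => by rw [abs_sub_comm]; exact hx n)
  have e1 : -Real.pi / (tau β ω / (K : ℝ) ^ 2) * (tau β ω / K) ^ 2 = -Real.pi * tau β ω := by
    field_simp
  rw [e1, hP] at hsum
  set q := Real.exp (-Real.pi / (tau β ω / (K : ℝ) ^ 2) / 4) with hq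
  -- `K ≥ 3τ` gives `K² / (4τ) ≥ 9τ / 4 ≥ 2τ`.
  have hqP : q ≤ P ^ 2 := by
    rw [← hP, ← Real.exp_nat_mul, hq, Real.exp_le_exp]
    have h9 : 9 * tau β ω ≤ (K : ℝ) ^ 2 / tau β ω := by
      rw [le_div_iff₀ hτ]
      nlinarith
    have e2 : -Real.pi / (tau β ω / (K : ℝ) ^ 2) / 4 = -(Real.pi * ((K : ℝ) ^ 2 / tau β ω) / 4) := by
      field_simp
    rw [e2]
    have := mul_le_mul_of_nonneg_left h9 Real.pi_pos.le
    have := mul_pos Real.pi_pos hτ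
    push_cast
    nlinarith
  have hq0 : 0 < q := Real.exp_pos _
  have hq2 : q ≤ P / 12 := hqP.trans (by nlinarith)
  have hfrac : 2 * q / (1 - q) ≤ 6 / 11 * P := by
    rw [div_le_iff₀ (by linarith)]
    nlinarith
  rw [filterKernel, thetaKernel]
  have hmass : 1 / Real.sqrt (tau β ω / (K : ℝ) ^ 2) ≤ filterMass β ω K := by
    rw [filterMass_eq hτ.le]
    exact one_div_sqrt_le_tsum_exp hb
  calc _ ≤ 1 / Real.sqrt (tau β ω / (K : ℝ) ^ 2) * (P + 6 / 11 * P) := by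
        gcongr
        linarith
    _ ≤ filterMass β ω K * (P + 6 / 11 * P) := by
        gcongr
    _ = _ := by ring

/-- Moving each tail index by `K` towards `0` is injective, and `k² ≥ K² + (|k| - K)²` for `|k| >
K`, so every tail weight is at most `exp (-π τ)` times the weight of its image. -/
theorem tsum_compl_gaussianWeight_le (h : ω < β) (h1 : β - ω ≤ 1) (hK : 0 < K) :
    ∑' k : {k : ℤ // k ∉ Finset.Icc (-(K : ℤ)) K}, gaussianWeight β ω K k ≤
      (β - ω) / 12 * filterMass β ω K := by
  have hτ := tau_pos h h1
  have hs := summable_gaussianWeight hτ hK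
  rw [filterMass, ← tsum_mul_left]
  refine Summable.tsum_le_tsum_of_inj
    (fun k => if 0 < (k : ℤ) then (k : ℤ) - K else (k : ℤ) + K) ?_
    (fun k _ => mul_nonneg (by linarith) (gaussianWeight_pos _ _ _ k).le) ?_
    (hs.subtype _) (hs.mul_left _)
  · rintro ⟨k, hk⟩ ⟨l, hl⟩ hkl
    simp only [Finset.mem_Icc, not_and_or, not_le] at hk hl
    simp only at hkl
    ext
    simp only
    split_ifs at hkl <;> omega
  · rintro ⟨k, hk⟩
    simp only [Finset.mem_Icc, not_and_or, not_le] at hk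
    have hkey : ∀ j : ℤ, (k : ℝ) ^ 2 ≥ (K : ℝ) ^ 2 + (j : ℝ) ^ 2 →
        gaussianWeight β ω K k ≤ (β - ω) / 12 * gaussianWeight β ω K j := by
      intro j hj
      rw [gaussianWeight_eq hτ.le, gaussianWeight_eq hτ.le, ← exp_neg_pi_mul_tau h, ← Real.exp_add,
        Real.exp_le_exp]
      have hc : 0 ≤ Real.pi * (tau β ω / (K : ℝ) ^ 2) := by positivity
      have := mul_le_mul_of_nonneg_left hj hc
      have hK0 : (K : ℝ) ≠ 0 := by positivity
      have e : Real.pi * (tau β ω / (K : ℝ) ^ 2) * ((K : ℝ) ^ 2 + (j : ℝ) ^ 2) =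
        Real.pi * tau β ω + Real.pi * (tau β ω / (K : ℝ) ^ 2) * (j : ℝ) ^ 2 := by
        field_simp
      linarith
    apply hkey
    have hKr : (0 : ℤ) < K := by exact_mod_cast hK
    have : (k : ℤ) ^ 2 ≥ (K : ℤ) ^ 2 + (if 0 < k then k - K else k + K) ^ 2 := by
      split_ifs with hk0
      · nlinarith [hk.resolve_left (by omega)]
      · nlinarith [hk.resolve_right (by omega)]
    exact_mod_cast this

/-- The `k`-th Fourier coefficient of the measure `∑ i, p i • δ_(θ i)`. -/
def fourierMoment {ι : Type*} [Fintype ι] (p θ : ι → ℝ) (k : ℤ) : ℂ :=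
  ∑ i, (p i : ℂ) * Complex.exp (-(2 * Real.pi * Complex.I * k * θ i))

theorem norm_fourierMoment_le {ι : Type*} [Fintype ι] {p : ι → ℝ} (hp : ∀ i, 0 ≤ p i) (θ : ι → ℝ)
    (k : ℤ) : ‖fourierMoment p θ k‖ ≤ ∑ i, p i := by
  refine (norm_sum_le _ _).trans (Finset.sum_le_sum fun i _ => ?_)
  rw [norm_mul, Complex.norm_real, Real.norm_eq_abs, abs_of_nonneg (hp i), Complex.norm_exp]
  simp

theorem hasSum_fourierMoment {ι : Type*} [Fintype ι] (p θ : ι → ℝ) (hτ : 0 < tau β ω)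
    (hK : 0 < K) (x : ℝ) :
    HasSum (fun k : ℤ => fourierMoment p θ k * gaussianWeight β ω K k *
      Complex.exp (2 * Real.pi * Complex.I * k * x))
      ((∑ i, p i * filterKernel β ω K (x - θ i) : ℝ) : ℂ) := by
  have := hasSum_sum (s := Finset.univ) (fun i _ =>
    (hasSum_filterKernel (β := β) (ω := ω) hτ hK (x - θ i)).mul_left (p i : ℂ))
  have e1 : (fun k : ℤ => fourierMoment p θ k * gaussianWeight β ω K k *
      Complex.exp (2 * Real.pi * Complex.I * k * x)) = fun k : ℤ => ∑ i, (p i : ℂ) *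
      (gaussianWeight β ω K k * Complex.exp (2 * Real.pi * Complex.I * k * (x - θ i : ℝ))) := by
    funext k
    rw [fourierMoment, Finset.sum_mul, Finset.sum_mul]
    refine Finset.sum_congr rfl fun i _ => ?_
    have e : (2 * Real.pi * Complex.I * k * ((x - θ i : ℝ) : ℂ)) =
        -(2 * Real.pi * Complex.I * k * θ i) + 2 * Real.pi * Complex.I * k * x := by
      push_cast; ring
    rw [e, Complex.exp_add]
    ring
  rw [e1, Complex.ofReal_sum]
  simpa only [Complex.ofReal_mul] using this

/-- The filtered signal. -/
def filteredSignal (β ω : ℝ) (K : ℕ) (y : ℤ → ℂ) (x : ℝ) : ℂ :=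
  ∑ k ∈ Finset.Icc (-(K : ℤ)) K, y k * gaussianWeight β ω K k *
    Complex.exp (2 * Real.pi * Complex.I * k * x)

/-- Frequencies `|k| ≤ K` contribute the measurement error `α`. Those beyond contribute only the
filter's tail, since all moments are bounded by the total mass. -/
theorem norm_filteredSignal_sub_le {ι : Type*} [Fintype ι] {p θ : ι → ℝ} (hp : ∀ i, 0 ≤ p i)
    (hp1 : ∑ i, p i ≤ 1) (h : ω < β) (h1 : β - ω ≤ 1) (hK : 0 < K) {α : ℝ} (hα : 0 ≤ α)
    {y : ℤ → ℂ} (hy : ∀ k ∈ Finset.Icc (-(K : ℤ)) K, ‖y k - fourierMoment p θ k‖ ≤ α) (x : ℝ) :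
    ‖filteredSignal β ω K y x - ((∑ i, p i * filterKernel β ω K (x - θ i) : ℝ) : ℂ)‖ ≤
      (α + (β - ω) / 12) * filterMass β ω K := by
  have hτ := tau_pos h h1
  have hs := summable_gaussianWeight (β := β) (ω := ω) hτ hK
  have hsum := hasSum_fourierMoment (β := β) (ω := ω) p θ hτ hK x
  have hexp : ∀ k : ℤ, ‖Complex.exp (2 * Real.pi * Complex.I * k * x)‖ = 1 := fun k => by
    rw [Complex.norm_exp]; simp
  have hg : ∀ k : ℤ, ‖(gaussianWeight β ω K k : ℂ)‖ = gaussianWeight β ω K k := fun k => by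
    rw [Complex.norm_real, Real.norm_eq_abs, abs_of_pos (gaussianWeight_pos _ _ _ k)]
  rw [← hsum.tsum_eq, ← hsum.summable.sum_add_tsum_subtype_compl (Finset.Icc (-(K : ℤ)) K),
    ← sub_sub, filteredSignal, ← Finset.sum_sub_distrib, add_mul]
  refine (norm_sub_le _ _).trans (add_le_add ?_ ?_)
  · calc _ ≤ ∑ k ∈ Finset.Icc (-(K : ℤ)) K, α * gaussianWeight β ω K k := by
          refine (norm_sum_le _ _).trans (Finset.sum_le_sum fun k hk => ?_)
          rw [← sub_mul, ← sub_mul, norm_mul, norm_mul, hexp, hg, mul_one]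
          exact mul_le_mul_of_nonneg_right (hy k hk) (gaussianWeight_pos _ _ _ k).le
      _ ≤ _ := by
          rw [← Finset.mul_sum]
          exact mul_le_mul_of_nonneg_left
            (hs.sum_le_tsum _ fun k _ => (gaussianWeight_pos _ _ _ k).le) hα
  · refine le_trans ?_ (tsum_compl_gaussianWeight_le h h1 hK)
    refine tsum_of_norm_bounded (hs.subtype _).hasSum (fun k => ?_)
    rw [norm_mul, norm_mul, hexp, hg, mul_one]
    exact mul_le_of_le_one_left (gaussianWeight_pos _ _ _ _).le
      ((norm_fourierMoment_le hp θ _).trans hp1)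

/-! ### Comparison of the filtered signal with the threshold -/

section Threshold

variable {ι κ : Type*} [Fintype ι] [Fintype κ] {p θ : ι → ℝ} {w μ : κ → ℝ} {α : ℝ} {y : ℤ → ℂ}

theorem norm_filteredSignal_sub_add_le (hp : ∀ i, 0 ≤ p i) (hw : ∀ j, 0 ≤ w j)
    (hpw : ∑ i, p i + ∑ j, w j ≤ 1) (h : ω < β) (h1 : β - ω ≤ 1) (hK : 0 < K) (hα : 0 ≤ α)
    (hy : ∀ k ∈ Finset.Icc (-(K : ℤ)) K,
      ‖y k - (fourierMoment p θ k + fourierMoment w μ k)‖ ≤ α) (x : ℝ) :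
    ‖filteredSignal β ω K y x - ((∑ i, p i * filterKernel β ω K (x - θ i) +
      ∑ j, w j * filterKernel β ω K (x - μ j) : ℝ) : ℂ)‖ ≤
      (α + (β - ω) / 12) * filterMass β ω K := by
  have := norm_filteredSignal_sub_le (p := Sum.elim p w) (θ := Sum.elim θ μ) (y := y)
    (by rintro (i | j); exacts [hp i, hw j]) (by simpa using hpw) h h1 hK hα
    (by simpa [fourierMoment] using hy) x
  simpa using this

/-- Positivity of the kernel means that other atoms and the residual can only help. Relative to the
filter mass, what remains exceeds `β - 5/12 * (β - ω) = (7β + 5ω) / 12`, which is larger than the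
threshold by `5/132 * (β - ω)`. -/
theorem lt_norm_filteredSignal (hω : 0 ≤ ω) (hp : ∀ i, β ≤ p i) (hw : ∀ j, 0 ≤ w j)
    (hpw : ∑ i, p i + ∑ j, w j ≤ 1) (h : ω < β) (h1 : β - ω ≤ 1) (hK : 0 < K) (hα : 0 ≤ α)
    (hα3 : α < (β - ω) / 3)
    (hy : ∀ k ∈ Finset.Icc (-(K : ℤ)) K,
      ‖y k - (fourierMoment p θ k + fourierMoment w μ k)‖ ≤ α) (i : ι) (n : ℤ) :
    (6 * β + 5 * ω) / 11 * filterMass β ω K < ‖filteredSignal β ω K y (θ i + n)‖ := by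
  have hτ := tau_pos h h1
  have hm : 0 < filterMass β ω K := filterMass_pos hτ hK
  have hp0 : ∀ i, 0 ≤ p i := fun i => by linarith [hp i]
  have hle := norm_filteredSignal_sub_add_le hp0 hw hpw h h1 hK hα hy (θ i + n)
  set G := (∑ i', p i' * filterKernel β ω K (θ i + n - θ i') +
      ∑ j, w j * filterKernel β ω K (θ i + n - μ j)) with hG
  have hG1 : β * filterMass β ω K ≤ G := by
    have h3 : p i * filterKernel β ω K (θ i + n - θ i) ≤
        ∑ i', p i' * filterKernel β ω K (θ i + n - θ i') :=
      Finset.single_le_sum (f := fun i' => p i' * filterKernel β ω K (θ i + n - θ i'))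
        (fun i' _ => mul_nonneg (hp0 i') (filterKernel_nonneg _)) (Finset.mem_univ i)
    rw [add_sub_cancel_left, filterKernel_int hτ hK] at h3
    have h4 : 0 ≤ ∑ j, w j * filterKernel β ω K (θ i + n - μ j) :=
      Finset.sum_nonneg fun j _ => mul_nonneg (hw j) (filterKernel_nonneg _)
    have := mul_le_mul_of_nonneg_right (hp i) hm.le
    linarith
  have h5 : G ≤ ‖(G : ℂ)‖ := by
    rw [Complex.norm_real]; exact le_abs_self _
  have h6 := norm_sub_norm_le (G : ℂ) (filteredSignal β ω K y (θ i + n))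
  rw [norm_sub_rev] at h6
  have h7 : (α + (β - ω) / 12) * filterMass β ω K < ((β - ω) / 3 + (β - ω) / 12) * filterMass β ω K :=
    mul_lt_mul_of_pos_right (by linarith) hm
  nlinarith

/-- The contributions `17/132 * (β - ω)`, `ω` and `5/12 * (β - ω)` add up to exactly the threshold;
strictness comes from `α < (β - ω) / 3`. -/
theorem norm_filteredSignal_lt (hp : ∀ i, 0 ≤ p i) (hw : ∀ j, 0 ≤ w j)
    (hpw : ∑ i, p i + ∑ j, w j ≤ 1) (hwω : ∑ j, w j ≤ ω) (h : ω < β) (h1 : β - ω ≤ 1)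
    (hK : 3 * tau β ω ≤ K) (hα : 0 ≤ α) (hα3 : α < (β - ω) / 3)
    (hy : ∀ k ∈ Finset.Icc (-(K : ℤ)) K,
      ‖y k - (fourierMoment p θ k + fourierMoment w μ k)‖ ≤ α) {x : ℝ}
    (hx : ∀ i, ∀ n : ℤ, tau β ω / K ≤ |x - (θ i + n)|) :
    ‖filteredSignal β ω K y x‖ < (6 * β + 5 * ω) / 11 * filterMass β ω K := by
  have hτ := tau_pos h h1
  have hK0 : 0 < K := by
    have : (0 : ℝ) < K := by linarith
    exact_mod_cast this
  have hm : 0 < filterMass β ω K := filterMass_pos hτ hK0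
  have hle := norm_filteredSignal_sub_add_le hp hw hpw h h1 hK0 hα hy x
  set G := (∑ i, p i * filterKernel β ω K (x - θ i) +
      ∑ j, w j * filterKernel β ω K (x - μ j)) with hG
  have hw0 : 0 ≤ ∑ j, w j := Finset.sum_nonneg fun j _ => hw j
  have hG1 : G ≤ 17 / 11 * ((β - ω) / 12) * filterMass β ω K + ω * filterMass β ω K := by
    refine add_le_add ?_ ?_
    · calc _ ≤ ∑ i, p i * (17 / 11 * ((β - ω) / 12) * filterMass β ω K) :=
            Finset.sum_le_sum fun i _ => mul_le_mul_of_nonneg_left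
              (filterKernel_le_of_forall_le h h1 hK fun n => by
                rw [sub_sub]; exact hx i n) (hp i)
        _ ≤ _ := by
            rw [← Finset.sum_mul]
            refine mul_le_of_le_one_left ?_ (by linarith)
            have : 0 ≤ β - ω := by linarith
            positivity
    · calc _ ≤ ∑ j, w j * filterMass β ω K :=
            Finset.sum_le_sum fun j _ => mul_le_mul_of_nonneg_left (filterKernel_le hτ hK0 _) (hw j)
        _ ≤ _ := by
            rw [← Finset.sum_mul]
            exact mul_le_mul_of_nonneg_right hwω hm.le
  have hG0 : 0 ≤ G := add_nonneg
    (Finset.sum_nonneg fun i _ => mul_nonneg (hp i) (filterKernel_nonneg _))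
    (Finset.sum_nonneg fun j _ => mul_nonneg (hw j) (filterKernel_nonneg _))
  have h5 : ‖(G : ℂ)‖ = G := by
    rw [Complex.norm_real, Real.norm_eq_abs, abs_of_nonneg hG0]
  have h6 := norm_sub_norm_le (filteredSignal β ω K y x) (G : ℂ)
  have h7 : (α + (β - ω) / 12) * filterMass β ω K < ((β - ω) / 3 + (β - ω) / 12) * filterMass β ω K :=
    mul_lt_mul_of_pos_right (by linarith) hm
  nlinarith

end Threshold

theorem continuous_filteredSignal (β ω : ℝ) (K : ℕ) (y : ℤ → ℂ) :
    Continuous (filteredSignal β ω K y) := by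
  unfold filteredSignal
  fun_prop

theorem superlevelSet_eq {N : ℕ} (d : RoundData K N) :
    superlevelSet β ω d = {x | (6 * β + 5 * ω) / 11 * filterMass β ω K <
      ‖filteredSignal β ω K (signal d) x‖} := rfl

theorem closure_superlevelSet_subset {N : ℕ} (d : RoundData K N) :
    closure (superlevelSet β ω d) ⊆ {x | (6 * β + 5 * ω) / 11 * filterMass β ω K ≤
      ‖filteredSignal β ω K (signal d) x‖} := by
  refine closure_minimal (fun x hx => ?_) ?_
  · rw [superlevelSet_eq, mem_ofPred_eq] at hx
    exact hx.le
  · exact isClosed_le continuous_const (continuous_filteredSignal _ _ _ _).norm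

end Filter

end

noncomputable section

/-! ### Intervals of the filled set -/

section Intervals

variable {ι : Type*} {β ω : ℝ} {K N : ℕ} {d : RoundData K N} {lam : ι → ℝ} {M : ℝ}

/-- A point in a filled gap is within half the gap length of an endpoint, hence the constant `3 /
2`. -/
theorem exists_abs_sub_lt_of_mem_filledSet
    (hX : ∀ x ∈ closure (superlevelSet β ω d), ∃ i, ∃ n : ℤ, |x - (M * lam i + n)| < tau β ω / K)
    {y : ℝ} (hy : y ∈ filledSet β ω d) :
    ∃ i, ∃ n : ℤ, |y - (M * lam i + n)| < 3 / 2 * (tau β ω / K) := by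
  rcases hy with hy | ⟨a, ha, b, hb, hay, hyb, hab⟩
  · obtain ⟨i, n, h⟩ := hX y hy
    exact ⟨i, n, by linarith [abs_nonneg (y - (M * lam i + n))]⟩
  · rcases le_total (y - a) (b - y) with hle | hle
    · obtain ⟨i, n, h⟩ := hX a ha
      refine ⟨i, n, ?_⟩
      rw [abs_lt] at h ⊢
      constructor <;> linarith [h.1, h.2]
    · obtain ⟨i, n, h⟩ := hX b hb
      refine ⟨i, n, ?_⟩
      rw [abs_lt] at h ⊢
      constructor <;> linarith [h.1, h.2]

theorem uIcc_subset_filledSet {a b : ℝ} (ha : a ∈ closure (superlevelSet β ω d))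
    (hb : b ∈ closure (superlevelSet β ω d)) (hab : |a - b| < tau β ω / K) :
    uIcc a b ⊆ filledSet β ω d := by
  wlog hle : a ≤ b generalizing a b
  · rw [uIcc_comm]
    exact this hb ha (by rwa [abs_sub_comm]) (le_of_not_ge hle)
  rw [uIcc_of_le hle]
  rw [abs_lt] at hab
  exact fun x hx => Or.inr ⟨a, ha, b, hb, hx.1, hx.2, by linarith [hab.1]⟩

/-- Every point of the filled set is connected, within the filled set, to a translate of some
`M * lam i`. -/
theorem exists_isPreconnected_subset_filledSet
    (hX : ∀ x ∈ closure (superlevelSet β ω d), ∃ i, ∃ n : ℤ, |x - (M * lam i + n)| < tau β ω / K)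
    (hmem : ∀ i, ∀ n : ℤ, M * lam i + n ∈ superlevelSet β ω d)
    {y : ℝ} (hy : y ∈ filledSet β ω d) :
    ∃ i, ∃ n : ℤ, ∃ s ⊆ filledSet β ω d, IsPreconnected s ∧ y ∈ s ∧ M * lam i + n ∈ s := by
  have hcl : ∀ a ∈ closure (superlevelSet β ω d), ∃ i, ∃ n : ℤ,
      uIcc a (M * lam i + n) ⊆ filledSet β ω d := fun a ha => by
    obtain ⟨i, n, h⟩ := hX a ha
    exact ⟨i, n, uIcc_subset_filledSet ha (subset_closure (hmem i n)) h⟩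
  rcases hy with hy | ⟨a, ha, b, hb, hay, hyb, hab⟩
  · obtain ⟨i, n, h⟩ := hcl y hy
    exact ⟨i, n, _, h, isPreconnected_uIcc, left_mem_uIcc, right_mem_uIcc⟩
  · obtain ⟨i, n, h⟩ := hcl a ha
    refine ⟨i, n, Icc a b ∪ uIcc a (M * lam i + n), union_subset (fun x hx =>
      Or.inr ⟨a, ha, b, hb, hx.1, hx.2, hab⟩) h, ?_, Or.inl ⟨hay, hyb⟩, Or.inr right_mem_uIcc⟩
    exact isPreconnected_Icc.union a (left_mem_Icc.mpr (hay.trans hyb)) left_mem_uIcc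
      isPreconnected_uIcc

/-- This is what gap filling buys: no interval is spurious, as each contains an alias of a true
frequency. -/
theorem exists_add_div_mem_of_mem_scaledIntervals (hM : 0 < M)
    (hX : ∀ x ∈ closure (superlevelSet β ω d), ∃ i, ∃ n : ℤ, |x - (M * lam i + n)| < tau β ω / K)
    (hmem : ∀ i, ∀ n : ℤ, M * lam i + n ∈ superlevelSet β ω d)
    {J : Set ℝ} (hJ : J ∈ scaledIntervals (filledSet β ω d) M) :
    ∃ i, ∃ n : ℤ, lam i + n / M ∈ J := by
  obtain ⟨x, hx, rfl⟩ := hJ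
  obtain ⟨i, n, s, hs, hsc, hxs, hns⟩ := exists_isPreconnected_subset_filledSet hX hmem hx
  refine ⟨i, n, ?_⟩
  have hpre : IsPreconnected ((fun z => z / M) '' s) :=
    hsc.image _ (by fun_prop)
  refine hpre.subset_connectedComponentIn ⟨M * x, hxs, by field_simp⟩ ?_
    ⟨_, hns, by field_simp⟩
  rintro _ ⟨z, hz, rfl⟩
  have : M * (z / M) = z := by field_simp
  change M * (z / M) ∈ filledSet β ω d
  rw [this]
  exact hs hz

/-- If the translates of `lam` by multiples of `1 / M` are well separated, then an interval stays
within one translate of the neighbourhood of `lam`. -/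
theorem subset_of_mem_scaledIntervals (hM : 0 < M)
    (hX : ∀ x ∈ closure (superlevelSet β ω d), ∃ i, ∃ n : ℤ, |x - (M * lam i + n)| < tau β ω / K)
    (hsep : ∀ i j, ∀ q : ℤ, q ≠ 0 → 3 * (tau β ω / K) / M ≤ |lam i + q / M - lam j|)
    {J : Set ℝ} (hJ : J ∈ scaledIntervals (filledSet β ω d) M) {i : ι} {n : ℤ}
    (hi : lam i + n / M ∈ J) {z : ℝ} (hz : z ∈ J) :
    ∃ j, |z - (lam j + n / M)| < 3 / 2 * (tau β ω / K) / M := by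
  obtain ⟨x, hx, rfl⟩ := hJ
  set r := 3 / 2 * (tau β ω / K) / M with hr
  -- The component is covered by the open sets `u q`. By `hsep`, aliases with different `q` are at
  -- least `2r` apart, so `u n` is disjoint from the others and connectedness confines the component
  -- to it.
  set u : ℤ → Set ℝ := fun q => ⋃ j, Metric.ball (lam j + q / M) r with hu
  have hopen : ∀ q, IsOpen (u q) := fun q => isOpen_iUnion fun j => Metric.isOpen_ball
  have hsub : connectedComponentIn {x | M * x ∈ filledSet β ω d} x ⊆
      u n ∪ ⋃ q ∈ {q : ℤ | q ≠ n}, u q := by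
    intro y hy
    have hy' : M * y ∈ filledSet β ω d :=
      connectedComponentIn_subset {x | M * x ∈ filledSet β ω d} x hy
    obtain ⟨j, q, hj⟩ := exists_abs_sub_lt_of_mem_filledSet hX hy'
    have hyq : y ∈ u q := by
      refine mem_iUnion.mpr ⟨j, ?_⟩
      rw [Metric.mem_ball, Real.dist_eq, hr, lt_div_iff₀ hM]
      calc |y - (lam j + q / M)| * M = |y - (lam j + q / M)| * |M| := by rw [abs_of_pos hM]
        _ = |M * y - (M * lam j + q)| := by
          rw [← abs_mul]; congr 1; field_simp
        _ < _ := hj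
    by_cases hq : q = n
    · exact Or.inl (hq ▸ hyq)
    · exact Or.inr (mem_biUnion (show q ∈ {q : ℤ | q ≠ n} from hq) hyq)
  have hdisj : Disjoint (u n) (⋃ q ∈ {q : ℤ | q ≠ n}, u q) := by
    rw [Set.disjoint_left]
    intro y hy hy'
    obtain ⟨j, hj⟩ := mem_iUnion.mp hy
    obtain ⟨q, hq, hyq⟩ := mem_iUnion₂.mp hy'
    obtain ⟨j', hj'⟩ := mem_iUnion.mp hyq
    have hqn : q - n ≠ 0 := sub_ne_zero.mpr hq
    have h := hsep j' j (q - n) hqn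
    rw [Metric.mem_ball, Real.dist_eq] at hj hj'
    have e : lam j' + ((q - n : ℤ) : ℝ) / M - lam j =
        (y - (lam j + n / M)) - (y - (lam j' + q / M)) := by
      push_cast; ring
    have h2 := abs_sub (y - (lam j + n / M)) (y - (lam j' + q / M))
    rw [e] at h
    have h3 : 3 * (tau β ω / K) / M = r + r := by rw [hr]; ring
    linarith
  have hr0 : 0 < r := by
    obtain ⟨j, q, hj⟩ := exists_abs_sub_lt_of_mem_filledSet hX hx
    have := (abs_nonneg _).trans_lt hj
    positivity
  have := isPreconnected_connectedComponentIn.subset_left_of_subset_union (hopen n)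
    (isOpen_biUnion fun q _ => hopen q) hdisj hsub
    ⟨_, hi, mem_iUnion.mpr ⟨i, Metric.mem_ball_self hr0⟩⟩ hz
  obtain ⟨j, hj⟩ := mem_iUnion.mp this
  exact ⟨j, by simpa [Metric.mem_ball, Real.dist_eq] using hj⟩

variable {F : Set ℝ}

/-- An interval containing `lam i + n / M` stays close to the alias of `lam` with index `n`. The
shift `-n` brings it back to `lam`, and any other shift lands it where `hF` says that `F` has no
points. -/
theorem exists_forall_of_mem_scaledIntervals (hM : 0 < M)
    (hX : ∀ x ∈ closure (superlevelSet β ω d), ∃ i, ∃ n : ℤ, |x - (M * lam i + n)| < tau β ω / K)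
    (hmem : ∀ i, ∀ n : ℤ, M * lam i + n ∈ superlevelSet β ω d)
    (hsep : ∀ i j, ∀ q : ℤ, q ≠ 0 → 3 * (tau β ω / K) / M ≤ |lam i + q / M - lam j|)
    (hF : ∀ z i, |z - lam i| < 3 / 2 * (tau β ω / K) / M → ∀ q : ℤ, q ≠ 0 → z + q / M ∉ F)
    (hlam : ∀ i, lam i ∈ F) {J : Set ℝ} (hJ : J ∈ scaledIntervals (filledSet β ω d) M) :
    ∃ n : ℤ, (translateSet J (n / M) ∩ F).Nonempty ∧
      (∀ q : ℤ, (translateSet J (q / M) ∩ F).Nonempty → q = n) ∧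
      ∀ z ∈ translateSet J (n / M), ∃ i, |z - lam i| < 3 / 2 * (tau β ω / K) / M := by
  obtain ⟨i, n, hi⟩ := exists_add_div_mem_of_mem_scaledIntervals hM hX hmem hJ
  have hnear : ∀ z ∈ J, ∃ j, |z - n / M - lam j| < 3 / 2 * (tau β ω / K) / M := fun z hz => by
    obtain ⟨j, hj⟩ := subset_of_mem_scaledIntervals hM hX hsep hJ hi hz
    exact ⟨j, by rwa [sub_sub, add_comm (n / M : ℝ)]⟩
  refine ⟨-n, ⟨lam i, ⟨_, hi, by push_cast; ring⟩, hlam i⟩, ?_, ?_⟩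
  · rintro q ⟨_, ⟨z, hz, rfl⟩, hzF⟩
    by_contra hq
    obtain ⟨j, hj⟩ := hnear z hz
    refine hF _ j hj (q + n) (by omega) ?_
    convert hzF using 1
    push_cast
    ring
  · rintro _ ⟨z, hz, rfl⟩
    obtain ⟨j, hj⟩ := hnear z hz
    refine ⟨j, ?_⟩
    convert hj using 3
    push_cast
    ring

theorem uniqueShifts_and_updateEstimate (hM : 0 < M)
    (hX : ∀ x ∈ closure (superlevelSet β ω d), ∃ i, ∃ n : ℤ, |x - (M * lam i + n)| < tau β ω / K)
    (hmem : ∀ i, ∀ n : ℤ, M * lam i + n ∈ superlevelSet β ω d)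
    (hsep : ∀ i j, ∀ q : ℤ, q ≠ 0 → 3 * (tau β ω / K) / M ≤ |lam i + q / M - lam j|)
    (hF : ∀ z i, |z - lam i| < 3 / 2 * (tau β ω / K) / M → ∀ q : ℤ, q ≠ 0 → z + q / M ∉ F)
    (hlam : ∀ i, lam i ∈ F) :
    UniqueShifts (filledSet β ω d) M F ∧
      (∀ i, lam i ∈ updateEstimate (filledSet β ω d) M F) ∧
      ∀ z ∈ updateEstimate (filledSet β ω d) M F, ∃ i, |z - lam i| < 3 / 2 * (tau β ω / K) / M := by
  refine ⟨fun J hJ => ?_, fun i => ?_, ?_⟩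
  · obtain ⟨n, h1, h2, -⟩ := exists_forall_of_mem_scaledIntervals hM hX hmem hsep hF hlam hJ
    exact ⟨n, h1, h2⟩
  · have hi : lam i ∈ {x : ℝ | M * x ∈ filledSet β ω d} := by
      have := hmem i 0
      rw [Int.cast_zero, add_zero] at this
      exact Or.inl (subset_closure this)
    -- The interval around `lam i` itself is kept through the shift `0`.
    have h0 : lam i ∈ translateSet (connectedComponentIn {x : ℝ | M * x ∈ filledSet β ω d} (lam i))
        ((0 : ℤ) / M) := ⟨lam i, mem_connectedComponentIn hi, by simp⟩
    exact ⟨_, ⟨lam i, hi, rfl⟩, 0, ⟨lam i, h0, hlam i⟩, h0⟩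
  · rintro z ⟨J, hJ, q, hq, hz⟩
    obtain ⟨n, -, h2, h3⟩ := exists_forall_of_mem_scaledIntervals hM hX hmem hsep hF hlam hJ
    obtain rfl := h2 q hq
    exact h3 z hz

end Intervals

end

noncomputable section

/-! ### Existence of a separating factor -/

-- For fixed `q` the bad `u` form an interval of length `3η / q`. Since `u ∈ [1/4, 1/2]`, only `q`
-- between `q₀` and `2 q₀` occur, so the total is at most `(q₀ + 1) * 3η / q₀ ≤ 6η`.
open MeasureTheory in
theorem volume_setOf_abs_mul_sub_le {η D : ℝ} (hη : 0 ≤ η) (hη1 : η ≤ 1 / 48) :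
    volume {u : ℝ | u ∈ Icc (1 / 4 : ℝ) (1 / 2) ∧ ∃ q : ℕ, 1 ≤ q ∧ |q * u - D| ≤ 3 / 2 * η} ≤
      ENNReal.ofReal (6 * η) := by
  set q₀ : ℕ := max 1 ⌈2 * D - 3 * η⌉₊ with hq₀
  have hq1 : 1 ≤ q₀ := le_max_left _ _
  have hqD : 2 * D - 3 * η ≤ q₀ :=
    (Nat.le_ceil _).trans (by exact_mod_cast le_max_right _ _)
  have hsub : {u : ℝ | u ∈ Icc (1 / 4 : ℝ) (1 / 2) ∧ ∃ q : ℕ, 1 ≤ q ∧ |q * u - D| ≤ 3 / 2 * η} ⊆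
      ⋃ q ∈ Finset.Icc q₀ (2 * q₀), Icc ((D - 3 / 2 * η) / q) ((D + 3 / 2 * η) / q) := by
    rintro u ⟨⟨hu1, hu2⟩, q, hq, hqu⟩
    rw [abs_le] at hqu
    have hq0 : (0 : ℝ) < q := by exact_mod_cast hq
    refine mem_biUnion (x := q) ?_ ⟨?_, ?_⟩
    · simp only [Finset.coe_Icc, mem_Icc]
      constructor
      · rw [hq₀, max_le_iff, Nat.ceil_le]
        refine ⟨hq, ?_⟩
        nlinarith [hqu.1]
      -- Here `q ≤ 4D + 6η ≤ 2 q₀ + 12η`, and `12η < 1`.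
      · have : (q : ℝ) < 2 * q₀ + 1 := by nlinarith [hqu.2]
        have : q < 2 * q₀ + 1 := by exact_mod_cast this
        omega
    · rw [div_le_iff₀ hq0]; linarith [hqu.1]
    · rw [le_div_iff₀ hq0]; linarith [hqu.2]
  have hq0r : (1 : ℝ) ≤ q₀ := by exact_mod_cast hq1
  calc _ ≤ volume (⋃ q ∈ Finset.Icc q₀ (2 * q₀),
          Icc ((D - 3 / 2 * η) / (q : ℝ)) ((D + 3 / 2 * η) / q)) := measure_mono hsub
    _ ≤ ∑ q ∈ Finset.Icc q₀ (2 * q₀),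
          volume (Icc ((D - 3 / 2 * η) / (q : ℝ)) ((D + 3 / 2 * η) / q)) :=
        measure_biUnion_finset_le _ _
    _ ≤ ∑ _q ∈ Finset.Icc q₀ (2 * q₀), ENNReal.ofReal (3 * η / q₀) := by
        refine Finset.sum_le_sum fun q hq => ?_
        rw [Real.volume_Icc]
        refine ENNReal.ofReal_le_ofReal ?_
        have hqq : (q₀ : ℝ) ≤ q := by exact_mod_cast (Finset.mem_Icc.mp hq).1
        calc _ = 3 * η / q := by ring
          _ ≤ _ := by gcongr
    _ = ENNReal.ofReal ((q₀ + 1 : ℕ) * (3 * η / q₀)) := by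
        rw [Finset.sum_const, Nat.card_Icc, nsmul_eq_mul, ENNReal.ofReal_mul (by positivity),
          ENNReal.ofReal_natCast]
        congr 2
        omega
    _ ≤ _ := by
        refine ENNReal.ofReal_le_ofReal ?_
        rw [mul_div_assoc', div_le_iff₀ (by linarith)]
        push_cast
        nlinarith

-- The bad sets of the `S(S-1)/2` unordered pairs have total measure at most `3ηS(S-1)`, less than
-- the length `1/4` of the interval. Equal indices need no exclusion, since `|q u| ≥ 1/4 > 3η / 2`.
open MeasureTheory in
theorem exists_forall_lt_abs_mul_sub {S : ℕ} (hS : 1 ≤ S) (x : Fin S → ℝ) {η : ℝ} (hη0 : 0 < η)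
    (hη : η ≤ 1 / (8 * S * (2 * S - 1))) :
    ∃ u ∈ Icc (1 / 4 : ℝ) (1 / 2), ∀ i j, ∀ q : ℤ, q ≠ 0 → 3 / 2 * η < |q * u - (x i - x j)| := by
  have hS1 : (1 : ℝ) ≤ S := by exact_mod_cast hS
  have hden : (0 : ℝ) < 8 * S * (2 * S - 1) := by nlinarith
  rw [le_div_iff₀ hden] at hη
  have hη8 : η ≤ 1 / 8 := by nlinarith
  set bad : Fin S → Fin S → Set ℝ := fun i j =>
    {u : ℝ | u ∈ Icc (1 / 4 : ℝ) (1 / 2) ∧ ∃ q : ℕ, 1 ≤ q ∧ |q * u - (|x i - x j|)| ≤ 3 / 2 * η}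
    with hbad
  have hvol : volume (⋃ i, ⋃ j ∈ Finset.Iio i, bad i j) < volume (Icc (1 / 4 : ℝ) (1 / 2)) := by
    have hpair : ∀ i, ∀ j ∈ Finset.Iio i, volume (bad i j) ≤ ENNReal.ofReal (6 * η) := by
      intro i j hj
      refine volume_setOf_abs_mul_sub_le hη0.le ?_
      -- A pair `j < i` forces `S ≥ 2`, which sharpens `η ≤ 1/8` to the required `η ≤ 1/48`.
      have : 2 ≤ S := by
        have := Fin.lt_def.mp (Finset.mem_Iio.mp hj)
        omega
      have : (2 : ℝ) ≤ S := by exact_mod_cast this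
      have : (6 : ℝ) ≤ S * (2 * S - 1) := by nlinarith
      nlinarith
    calc _ ≤ ∑ i, volume (⋃ j ∈ Finset.Iio i, bad i j) := measure_iUnion_fintype_le _ _
      _ ≤ ∑ i : Fin S, ∑ _j ∈ Finset.Iio i, ENNReal.ofReal (6 * η) :=
        Finset.sum_le_sum fun i _ =>
          (measure_biUnion_finset_le _ _).trans (Finset.sum_le_sum (hpair i))
      _ = ENNReal.ofReal ((∑ i ∈ Finset.range S, i : ℕ) * (6 * η)) := by
        simp only [Finset.sum_const, Fin.card_Iio, nsmul_eq_mul]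
        rw [← Finset.sum_mul, ENNReal.ofReal_mul (p := ((∑ i ∈ Finset.range S, i : ℕ) : ℝ)) (by positivity),
          ENNReal.ofReal_natCast, ← Fin.sum_univ_eq_sum_range (fun i => i)]
        push_cast
        rfl
      _ < _ := by
        rw [Real.volume_Icc]
        refine (ENNReal.ofReal_lt_ofReal_iff (by norm_num)).mpr ?_
        have h2 : ((∑ i ∈ Finset.range S, i : ℕ) : ℝ) * 2 = S * (S - 1) := by
          have := Finset.sum_range_id_mul_two S
          have h3 : ((∑ i ∈ Finset.range S, i) * 2 : ℕ) = ((S * (S - 1) : ℕ) : ℝ) := by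
            exact_mod_cast this
          push_cast [Nat.cast_sub hS] at h3 ⊢
          exact h3
        nlinarith
  obtain ⟨u, hu, hnot⟩ : (Icc (1 / 4 : ℝ) (1 / 2) \ ⋃ i, ⋃ j ∈ Finset.Iio i, bad i j).Nonempty := by
    rw [Set.sdiff_nonempty]
    exact fun h => absurd (measure_mono h) (not_le.mpr hvol)
  refine ⟨u, hu, fun i j q hq => ?_⟩
  have hlt : ∀ i j, j < i → 3 / 2 * η < |(q.natAbs : ℝ) * u - (|x i - x j|)| := by
    intro i j hij
    by_contra hle
    refine hnot (mem_iUnion.mpr ⟨i, mem_biUnion (x := j) (by simpa using hij) ⟨hu, q.natAbs, ?_, ?_⟩⟩)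
    · exact Nat.one_le_iff_ne_zero.mpr (by simpa using hq)
    · exact not_lt.mp hle
  have hqabs : (q.natAbs : ℝ) * u = |(q : ℝ) * u| := by
    rw [abs_mul, abs_of_nonneg (by linarith [hu.1] : 0 ≤ u), Nat.cast_natAbs, Int.cast_abs]
  rcases lt_trichotomy j i with hij | hij | hij
  · have := hlt i j hij
    rw [hqabs] at this
    exact this.trans_le (abs_abs_sub_abs_le _ _)
  · rw [hij, sub_self, sub_zero, ← hqabs]
    have : (1 : ℝ) ≤ q.natAbs := by exact_mod_cast Nat.one_le_iff_ne_zero.mpr (by simpa using hq)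
    nlinarith [hu.1]
  · have := hlt j i hij
    rw [hqabs, abs_sub_comm (x j)] at this
    exact this.trans_le (abs_abs_sub_abs_le _ _)

/-- A separating factor exists as soon as the estimate is close to the `S` dominant frequencies. -/
theorem exists_separates {S : ℕ} (hS : 1 ≤ S) (lam : Fin S → ℝ) {η M : ℝ} (hη0 : 0 < η)
    (hη : η ≤ 1 / (8 * S * (2 * S - 1))) (hM : 0 < M) {F : Set ℝ}
    (hF : ∀ z ∈ F, ∃ i, |z - lam i| ≤ η / (2 * M)) :
    ∃ m ∈ Icc (2 : ℝ) 4, Separates η M F m := by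
  obtain ⟨u, ⟨hu1, hu2⟩, hu⟩ := exists_forall_lt_abs_mul_sub hS (fun i => M * lam i) hη0 hη
  have hu0 : 0 < u := by linarith
  refine ⟨1 / u, ⟨?_, ?_⟩, fun q hq => ?_⟩
  · rw [le_div_iff₀ hu0]; linarith
  · rw [div_le_iff₀ hu0]; linarith
  rw [Set.eq_empty_iff_forall_notMem]
  rintro _ ⟨⟨y, hy, rfl⟩, hyF⟩
  obtain ⟨t, ht, hty⟩ := mem_iUnion₂.mp hy
  obtain ⟨i, hi⟩ := hF _ hyF
  obtain ⟨j, hj⟩ := hF t ht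
  have h := hu i j q hq
  have hyt : |y - t| ≤ η / (2 * M) := by
    rw [abs_le]; constructor <;> linarith [hty.1, hty.2]
  have e : (q : ℝ) * u - (M * lam i - M * lam j) =
      M * ((y + q / (M * (1 / u)) - lam i) - ((y - t) + (t - lam j))) := by
    field_simp
    ring
  rw [e, abs_mul, abs_of_pos hM] at h
  have h2 := abs_sub (y + q / (M * (1 / u)) - lam i) ((y - t) + (t - lam j))
  -- Three errors of size `η / (2M)`, one from the enlarged neighbourhood and two from approximating
  -- points of `F` by frequencies, explain the margin `3η / 2`.
  have h3 := abs_add_le (y - t) (t - lam j)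
  have h4 : M * |(y + q / (M * (1 / u)) - lam i) - ((y - t) + (t - lam j))| ≤
      M * (η / (2 * M) + (η / (2 * M) + η / (2 * M))) := by
    refine mul_le_mul_of_nonneg_left ?_ hM.le
    linarith
  have h5 : M * (η / (2 * M) + (η / (2 * M) + η / (2 * M))) = 3 / 2 * η := by
    field_simp
    ring
  linarith

end

noncomputable section

/-! ### Hadamard tests and the spectral measure -/

section Spectral

variable {E : Type*} [NormedAddCommGroup E] [InnerProductSpace ℂ E]

theorem hadamardState_zero (U : E →L[ℂ] E) (ψ : E) (part : Fin 2) :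
    hadamardState U ψ part 0 = (1 / 2 : ℝ) • (ψ + partPhase part • U ψ) := by
  have h2 : (1 / Real.sqrt 2) * (1 / Real.sqrt 2) = (1 / 2 : ℝ) := by
    rw [div_mul_div_comm, Real.mul_self_sqrt (by norm_num)]; norm_num
  simp only [hadamardState, ancillaHadamard, ancillaPhase, controlled, Matrix.cons_val_zero,
    Matrix.cons_val_one, add_zero, sub_zero, ContinuousLinearMap.map_smul_of_tower]
  rw [smul_comm (partPhase part) (1 / Real.sqrt 2) (U ψ), ← smul_add, smul_smul, h2]

theorem hadamardState_one (U : E →L[ℂ] E) (ψ : E) (part : Fin 2) :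
    hadamardState U ψ part 1 = (1 / 2 : ℝ) • (ψ - partPhase part • U ψ) := by
  have h2 : (1 / Real.sqrt 2) * (1 / Real.sqrt 2) = (1 / 2 : ℝ) := by
    rw [div_mul_div_comm, Real.mul_self_sqrt (by norm_num)]; norm_num
  simp only [hadamardState, ancillaHadamard, ancillaPhase, controlled, Matrix.cons_val_zero,
    Matrix.cons_val_one, add_zero, sub_zero, ContinuousLinearMap.map_smul_of_tower]
  rw [smul_comm (partPhase part) (1 / Real.sqrt 2) (U ψ), ← smul_sub, smul_smul, h2]

theorem norm_sq_hadamardState_sub (U : E →L[ℂ] E) (ψ : E) (part : Fin 2) :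
    ‖hadamardState U ψ part 0‖ ^ 2 - ‖hadamardState U ψ part 1‖ ^ 2 =
      (partPhase part * inner ℂ ψ (U ψ)).re := by
  rw [hadamardState_zero, hadamardState_one, norm_smul, norm_smul, mul_pow, mul_pow,
    norm_add_sq (𝕜 := ℂ), norm_sub_sq (𝕜 := ℂ), inner_smul_right]
  simp only [RCLike.re_to_complex]
  norm_num
  ring

variable [CompleteSpace E]

/-- The mean of the outcome `±1` of the Hadamard test. -/
def testMean (H : selfAdjoint (E →L[ℂ] E)) (ψ : Metric.sphere (0 : E) 1) (t : ℝ) (part : Fin 2) : ℝ :=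
  (hadamardTest H ψ t part 0).toReal - (hadamardTest H ψ t part 1).toReal

theorem testMean_eq (H : selfAdjoint (E →L[ℂ] E)) (ψ : Metric.sphere (0 : E) 1) (t : ℝ)
    (part : Fin 2) :
    testMean H ψ t part = (partPhase part * inner ℂ (ψ : E) (evolution H t ψ)).re := by
  rw [← norm_sq_hadamardState_sub, testMean, hadamardTest, PMF.ofFintype_apply,
    PMF.ofFintype_apply, ENNReal.toReal_ofReal (by positivity), ENNReal.toReal_ofReal (by positivity)]

theorem testMean_zero_add_testMean_one (H : selfAdjoint (E →L[ℂ] E))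
    (ψ : Metric.sphere (0 : E) 1) (t : ℝ) :
    (testMean H ψ t 0 + testMean H ψ t 1 * Complex.I : ℂ) =
      inner ℂ (ψ : E) (evolution H t ψ) := by
  rw [testMean_eq, testMean_eq]
  apply Complex.ext <;> simp [partPhase]

/-- The exponential series is applied to the eigenvector term by term. -/
theorem evolution_apply_of_eigenvector (H : selfAdjoint (E →L[ℂ] E)) {x : E} {μ : ℝ}
    (hx : (H : E →L[ℂ] E) x = (μ : ℂ) • x) (t : ℝ) :
    evolution H t x = Complex.exp (-(2 * Real.pi * Complex.I * t * μ)) • x := by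
  set A : E →L[ℂ] E := (-(2 * Real.pi * t : ℝ) * Complex.I : ℂ) • (H : E →L[ℂ] E) with hA
  set a : ℂ := -(2 * Real.pi * Complex.I * t * μ) with ha
  have hAx : A x = a • x := by
    rw [hA, smul_apply, hx, smul_smul, ha]
    congr 1
    push_cast
    ring
  have hpow : ∀ n : ℕ, (A ^ n) x = a ^ n • x := by
    intro n
    induction n with
    | zero => simp
    | succ n ih =>
      rw [pow_succ, mul_apply_eq_comp, hAx, map_smul, ih, smul_smul, pow_succ, mul_comm]
  have h1 := (NormedSpace.exp_series_hasSum_exp' (𝕂 := ℂ) A).mapL (ContinuousLinearMap.apply ℂ E x)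
  have h2 := (NormedSpace.exp_series_hasSum_exp' (𝕂 := ℂ) a).smul_const x
  rw [← Complex.exp_eq_exp_ℂ] at h2
  refine HasSum.unique (f := fun n : ℕ => ((n.factorial : ℂ)⁻¹ • a ^ n) • x) ?_ h2
  convert h1 using 2 with n
  · simp [hpow, smul_smul]
  · rfl

/-- The weights `w` are the squared coefficients of `r` in an eigenbasis of `H`. The cross terms
vanish because the evolved residual stays orthogonal to every `v s`. -/
theorem inner_evolution_eq [FiniteDimensional ℂ E] (H : selfAdjoint (E →L[ℂ] E)) {S : ℕ}
    {lam : Fin S → ℝ} {v : Fin S → E} (c : Fin S → ℂ) {r : E} (hv : Orthonormal ℂ v)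
    (hH : ∀ s, (H : E →L[ℂ] E) (v s) = (lam s : ℂ) • v s) (hr : ∀ s, inner ℂ (v s) r = 0) :
    ∃ (n : ℕ) (w μ : Fin n → ℝ), (∀ j, 0 ≤ w j) ∧ ∑ j, w j = ‖r‖ ^ 2 ∧
      ∀ t : ℝ, inner ℂ ((∑ s, c s • v s) + r) (evolution H t ((∑ s, c s • v s) + r)) =
        ∑ s, ((‖c s‖ ^ 2 : ℝ) : ℂ) * Complex.exp (-(2 * Real.pi * Complex.I * t * lam s)) +
        ∑ j, (w j : ℂ) * Complex.exp (-(2 * Real.pi * Complex.I * t * μ j)) := by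
  have hsymm : ((H : E →L[ℂ] E) : E →ₗ[ℂ] E).IsSymmetric :=
    ContinuousLinearMap.isSelfAdjoint_iff_isSymmetric.mp H.2
  set e := hsymm.eigenvectorBasis rfl with he
  set μ := hsymm.eigenvalues rfl with hμ
  have heig : ∀ j, (H : E →L[ℂ] E) (e j) = (μ j : ℂ) • e j := fun j =>
    hsymm.apply_eigenvectorBasis rfl j
  refine ⟨_, fun j => ‖inner ℂ (e j) r‖ ^ 2, μ, fun j => by positivity,
    e.sum_sq_norm_inner_right r, fun t => ?_⟩
  have hUr : evolution H t r = ∑ j, (inner ℂ (e j) r *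
      Complex.exp (-(2 * Real.pi * Complex.I * t * μ j))) • e j := by
    conv_lhs => rw [← e.sum_repr' r]
    rw [map_sum]
    refine Finset.sum_congr rfl fun j _ => ?_
    rw [map_smul, evolution_apply_of_eigenvector H (heig j), smul_smul]
  have hvUr : ∀ s, inner ℂ (v s) (evolution H t r) = 0 := by
    intro s
    rw [hUr, inner_sum]
    -- The basis `e` need not contain `v s`. By symmetry of `H`, either `e j ⟂ v s` or the
    -- eigenvalues agree, so the phase of `μ j` may be replaced by that of `lam s` and factored out.
    have hterm : ∀ j, inner ℂ (v s) ((inner ℂ (e j) r *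
        Complex.exp (-(2 * Real.pi * Complex.I * t * μ j))) • e j) =
        Complex.exp (-(2 * Real.pi * Complex.I * t * lam s)) *
          inner ℂ (v s) (inner ℂ (e j) r • e j) := by
      intro j
      have h1 : inner ℂ (v s) ((H : E →L[ℂ] E) (e j)) = inner ℂ ((H : E →L[ℂ] E) (v s)) (e j) :=
        (hsymm (v s) (e j)).symm
      rw [heig, hH, inner_smul_left, inner_smul_right, Complex.conj_ofReal] at h1
      rw [inner_smul_right, inner_smul_right]
      rcases mul_eq_mul_right_iff.mp h1 with h | h
      · rw [h]; ring
      · rw [h]; ring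
    rw [Finset.sum_congr rfl fun j _ => hterm j, ← Finset.mul_sum, ← inner_sum, e.sum_repr', hr,
      mul_zero]
  have hUv : evolution H t (∑ s, c s • v s) =
      ∑ s, (c s * Complex.exp (-(2 * Real.pi * Complex.I * t * lam s))) • v s := by
    rw [map_sum]
    refine Finset.sum_congr rfl fun s _ => ?_
    rw [map_smul, evolution_apply_of_eigenvector H (hH s), smul_smul]
  have hrv : ∀ s, inner ℂ r (v s) = 0 := fun s => by rw [inner_eq_zero_symm]; exact hr s
  have hconj : ∀ z : ℂ, ((‖z‖ ^ 2 : ℝ) : ℂ) = (starRingEnd ℂ) z * z := fun z => by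
    rw [mul_comm, Complex.mul_conj, Complex.normSq_eq_norm_sq]
  rw [map_add, inner_add_left, inner_add_right, inner_add_right]
  have h12 : inner ℂ (∑ s, c s • v s) (evolution H t r) = 0 := by
    rw [sum_inner]
    exact Finset.sum_eq_zero fun s _ => by rw [inner_smul_left, hvUr, mul_zero]
  have h21 : inner ℂ r (evolution H t (∑ s, c s • v s)) = 0 := by
    rw [hUv, inner_sum]
    exact Finset.sum_eq_zero fun s _ => by rw [inner_smul_right, hrv, mul_zero]
  rw [h12, h21, add_zero, zero_add, hUv, hv.inner_sum]
  congr 1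
  · refine Finset.sum_congr rfl fun s _ => ?_
    rw [hconj]
    ring
  · rw [hUr, inner_sum]
    refine Finset.sum_congr rfl fun j _ => ?_
    rw [inner_smul_right, hconj, inner_conj_symm]
    ring

theorem evolution_zero (H : selfAdjoint (E →L[ℂ] E)) (x : E) : evolution H 0 x = x := by
  simp [evolution]

end Spectral

/-! ### Accuracy of the averaged signal -/

section Accuracy

variable {E : Type*} [NormedAddCommGroup E] [InnerProductSpace ℂ E] [CompleteSpace E] {K N : ℕ}

/-- All the averages of a round are within `a` of their means. -/
def IsAccurate (H : selfAdjoint (E →L[ℂ] E)) (ψ : Metric.sphere (0 : E) 1) (a M : ℝ)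
    (d : RoundData K N) : Prop :=
  ∀ k part, |averagedPart d k part - testMean H ψ (M * (k : ℕ)) part| ≤ a

theorem norm_averagedSignal_sub_le {H : selfAdjoint (E →L[ℂ] E)} {ψ : Metric.sphere (0 : E) 1}
    {α M : ℝ} (hα : 0 ≤ α) {d : RoundData K N} (hd : IsAccurate H ψ (α / Real.sqrt 2) M d)
    (k : Fin (K + 1)) :
    ‖averagedSignal d k - inner ℂ (ψ : E) (evolution H (M * (k : ℕ)) ψ)‖ ≤ α := by
  rw [← testMean_zero_add_testMean_one, averagedSignal]
  have e : (averagedPart d k 0 + averagedPart d k 1 * Complex.I -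
      (testMean H ψ (M * (k : ℕ)) 0 + testMean H ψ (M * (k : ℕ)) 1 * Complex.I) : ℂ) =
      ((averagedPart d k 0 - testMean H ψ (M * (k : ℕ)) 0 : ℝ) : ℂ) +
      ((averagedPart d k 1 - testMean H ψ (M * (k : ℕ)) 1 : ℝ) : ℂ) * Complex.I := by
    push_cast; ring
  rw [e, Complex.norm_add_mul_I]
  refine Real.sqrt_le_iff.mpr ⟨hα, ?_⟩
  have h0 := pow_le_pow_left₀ (abs_nonneg _) (hd k 0) 2
  have h1 := pow_le_pow_left₀ (abs_nonneg _) (hd k 1) 2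
  rw [sq_abs, div_pow, Real.sq_sqrt (by norm_num)] at h0 h1
  linarith

theorem fourierMoment_neg {ι : Type*} [Fintype ι] (p θ : ι → ℝ) (k : ℤ) :
    fourierMoment p θ (-k) = (starRingEnd ℂ) (fourierMoment p θ k) := by
  rw [fourierMoment, fourierMoment, map_sum]
  refine Finset.sum_congr rfl fun i _ => ?_
  rw [map_mul, Complex.conj_ofReal, ← Complex.exp_conj]
  congr 2
  simp only [map_neg, map_mul, map_ofNat, Complex.conj_ofReal, Complex.conj_I, map_intCast]
  push_cast
  ring

/-- Negative `k` follow by conjugation, as moments of a real measure satisfy the same symmetry as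
`signal`. -/
theorem norm_signal_sub_le {ι κ : Type*} [Fintype ι] [Fintype κ] {H : selfAdjoint (E →L[ℂ] E)}
    {ψ : Metric.sphere (0 : E) 1} {p lam : ι → ℝ} {w μ : κ → ℝ}
    (hψ : ∀ t : ℝ, inner ℂ (ψ : E) (evolution H t ψ) =
        ∑ s, (p s : ℂ) * Complex.exp (-(2 * Real.pi * Complex.I * t * lam s)) +
        ∑ j, (w j : ℂ) * Complex.exp (-(2 * Real.pi * Complex.I * t * μ j)))
    {α M : ℝ} (hα : 0 ≤ α) {d : RoundData K N} (hd : IsAccurate H ψ (α / Real.sqrt 2) M d)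
    {k : ℤ} (hk : k ∈ Finset.Icc (-(K : ℤ)) K) :
    ‖signal d k - (fourierMoment p (fun i => M * lam i) k +
      fourierMoment w (fun j => M * μ j) k)‖ ≤ α := by
  have hnat : ∀ l : ℕ, l ≤ K → ‖averagedSignal d (Fin.ofNat (K + 1) l) -
      (fourierMoment p (fun i => M * lam i) l + fourierMoment w (fun j => M * μ j) l)‖ ≤ α := by
    intro l hl
    have h := norm_averagedSignal_sub_le hα hd (Fin.ofNat (K + 1) l)
    have hv : ((Fin.ofNat (K + 1) l : Fin (K + 1)) : ℕ) = l := by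
      simp [Fin.ofNat, Nat.mod_eq_of_lt (Nat.lt_succ_of_le hl)]
    rw [hv, hψ] at h
    convert h using 4
    · refine Finset.sum_congr rfl fun i _ => ?_
      congr 2
      push_cast
      ring
    · refine Finset.sum_congr rfl fun i _ => ?_
      congr 2
      push_cast
      ring
  rw [Finset.mem_Icc] at hk
  have h := hnat k.natAbs (by omega)
  rw [signal]
  split_ifs with h0
  · rwa [Int.natAbs_of_nonneg h0] at h
  · have hneg : k = -(k.natAbs : ℤ) := by omega
    conv_lhs => rw [hneg, fourierMoment_neg, fourierMoment_neg, ← map_add, Int.natAbs_neg,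
      Int.natAbs_natCast, ← map_sub, RCLike.norm_conj]
    exact h

end Accuracy

end

noncomputable section

/-! ### Concentration -/

section Concentration

/-- Hoeffding's lemma for values in `[-1, 1]`, an interval of half-length `1`. -/
theorem sum_mul_exp_le_exp (p : PMF (Fin 2)) (t : ℝ) :
    ∑ b, p b * ENNReal.ofReal (Real.exp (t * ((-1 : ℝ) ^ (b : ℕ) -
      ((p 0).toReal - (p 1).toReal)))) ≤ ENNReal.ofReal (Real.exp (t ^ 2 / 2)) := by
  have hmean : ∫ b, (-1 : ℝ) ^ (b : ℕ) ∂p.toMeasure = (p 0).toReal - (p 1).toReal := by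
    rw [PMF.integral_eq_sum]
    simp [Fin.sum_univ_two, sub_eq_add_neg]
  have hmem : ∀ᵐ b ∂p.toMeasure, (-1 : ℝ) ^ ((b : Fin 2) : ℕ) ∈ Icc (-1 : ℝ) 1 :=
    Filter.Eventually.of_forall fun b => by fin_cases b <;> simp
  have h := (ProbabilityTheory.hasSubgaussianMGF_of_mem_Icc
    (Measurable.of_discrete (f := fun b : Fin 2 => (-1 : ℝ) ^ (b : ℕ))).aemeasurable hmem).mgf_le t
  rw [hmean, ProbabilityTheory.mgf, PMF.integral_eq_sum] at h
  have hc : ((((‖(1 : ℝ) - -1‖₊ / 2) ^ 2 : NNReal)) : ℝ) = 1 := by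
    push_cast
    norm_num
  rw [hc, one_mul] at h
  have e : ∀ b, p b * ENNReal.ofReal (Real.exp (t * ((-1 : ℝ) ^ (b : ℕ) -
      ((p 0).toReal - (p 1).toReal)))) = ENNReal.ofReal ((p b).toReal *
      Real.exp (t * ((-1 : ℝ) ^ (b : ℕ) - ((p 0).toReal - (p 1).toReal)))) := fun b => by
    rw [ENNReal.ofReal_mul ENNReal.toReal_nonneg, ENNReal.ofReal_toReal (p.apply_ne_top b)]
  rw [Finset.sum_congr rfl fun b _ => e b, ← ENNReal.ofReal_sum_of_nonneg fun b _ => by positivity]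
  exact ENNReal.ofReal_le_ofReal h

/-- Chernoff's bound for a weighted sum of independent centred signs. -/
theorem independentLaw_toOuterMeasure_le {ι : Type*} [Fintype ι] [DecidableEq ι]
    (p : ι → PMF (Fin 2)) (a : ι → ℝ) (c : ℝ) :
    (independentLaw p).toOuterMeasure {d | c ≤ ∑ i, a i * ((-1 : ℝ) ^ (d i : ℕ) -
      ((p i 0).toReal - (p i 1).toReal))} ≤
      ENNReal.ofReal (Real.exp ((∑ i, a i ^ 2) / 2 - c)) := by
  set f : ι → Fin 2 → ℝ := fun i b => a i * ((-1 : ℝ) ^ (b : ℕ) -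
    ((p i 0).toReal - (p i 1).toReal)) with hf
  rw [PMF.toOuterMeasure_apply_fintype]
  -- Markov's inequality for the exponential; the Chernoff parameter is absorbed into the weights
  -- `a`.
  calc _ ≤ ∑ d : ι → Fin 2, ENNReal.ofReal (Real.exp (-c)) *
        ∏ i, p i (d i) * ENNReal.ofReal (Real.exp (f i (d i))) := by
        refine Finset.sum_le_sum fun d _ => Set.indicator_apply_le' (fun hd => ?_) fun _ => zero_le
        rw [Finset.prod_mul_distrib, ← ENNReal.ofReal_prod_of_nonneg fun i _ => (Real.exp_pos _).le,
          ← Real.exp_sum, mul_left_comm, ← ENNReal.ofReal_mul (Real.exp_pos _).le, ← Real.exp_add]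
        refine le_mul_of_one_le_right zero_le ?_
        rw [ENNReal.one_le_ofReal, Real.one_le_exp_iff]
        have : c ≤ ∑ i, f i (d i) := hd
        linarith
    _ = ENNReal.ofReal (Real.exp (-c)) *
        ∏ i, ∑ b, p i b * ENNReal.ofReal (Real.exp (f i b)) := by
        rw [← Finset.mul_sum, Fintype.prod_sum]
    _ ≤ ENNReal.ofReal (Real.exp (-c)) * ∏ i, ENNReal.ofReal (Real.exp (a i ^ 2 / 2)) := by
        gcongr with i
        exact sum_mul_exp_le_exp (p i) (a i)
    _ = _ := by
        rw [← ENNReal.ofReal_prod_of_nonneg fun i _ => (Real.exp_pos _).le, ← Real.exp_sum,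
          ← ENNReal.ofReal_mul (Real.exp_pos _).le, ← Real.exp_add, Finset.sum_div]
        congr 2
        ring

variable {E : Type*} [NormedAddCommGroup E] [InnerProductSpace ℂ E] [CompleteSpace E] {K N : ℕ}

theorem sum_ite_testIndex (k : Fin (K + 1)) (part : Fin 2) (g : TestIndex K N → ℝ) :
    ∑ i : TestIndex K N, (if i.1 = k ∧ i.2.1 = part then g i else 0) = ∑ j, g (k, part, j) := by
  rw [Fintype.sum_prod_type, Finset.sum_eq_single k, Fintype.sum_prod_type,
    Finset.sum_eq_single part]
  · simp
  · intro b _ hb; simp [hb]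
  · simp
  · intro b _ hb; simp [hb]
  · simp

/-- Hoeffding's inequality for one average. -/
theorem roundLaw_toOuterMeasure_le (H : selfAdjoint (E →L[ℂ] E)) (ψ : Metric.sphere (0 : E) 1)
    (M : ℝ) {s σ : ℝ} (hs : 0 ≤ s) (hσ : σ ^ 2 = 1) (k : Fin (K + 1)) (part : Fin 2)
    (hN : 0 < N / 2) :
    (roundLaw H ψ K N M).toOuterMeasure
      {d | s ≤ σ * (averagedPart d k part - testMean H ψ (M * (k : ℕ)) part)} ≤
      ENNReal.ofReal (Real.exp (-((N / 2 : ℕ) * s ^ 2 / 2))) := by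
  have hN' : (0 : ℝ) < (N / 2 : ℕ) := by exact_mod_cast hN
  -- Only the `N / 2` repetitions of this test count, with the optimal Chernoff parameter `s`; the
  -- sign `σ` selects the tail.
  set a : TestIndex K N → ℝ := fun i => if i.1 = k ∧ i.2.1 = part then σ * s else 0 with ha
  have h := independentLaw_toOuterMeasure_le
    (fun i : TestIndex K N => hadamardTest H ψ (M * (i.1 : ℕ)) i.2.1) a ((N / 2 : ℕ) * s ^ 2)
  have h1 : ∑ i, a i ^ 2 = (N / 2 : ℕ) * s ^ 2 := by
    have := sum_ite_testIndex (N := N) k part (fun _ => (σ * s) ^ 2)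
    simp only [Finset.sum_const, Finset.card_univ, Fintype.card_fin, nsmul_eq_mul] at this
    rw [← one_mul (s ^ 2), ← hσ, ← mul_pow, ← this]
    refine Finset.sum_congr rfl fun i _ => ?_
    rw [ha]
    split_ifs <;> simp_all
  rw [h1] at h
  have e : (N / 2 : ℕ) * s ^ 2 / 2 - (N / 2 : ℕ) * s ^ 2 = -((N / 2 : ℕ) * s ^ 2 / 2) := by ring
  rw [e] at h
  refine le_trans ((roundLaw H ψ K N M).toOuterMeasure.mono fun d hd => ?_) h
  rw [mem_ofPred_eq] at hd ⊢
  have h2 : ∑ i : TestIndex K N, a i * ((-1 : ℝ) ^ (d i : ℕ) -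
      ((hadamardTest H ψ (M * (i.1 : ℕ)) i.2.1 0).toReal -
        (hadamardTest H ψ (M * (i.1 : ℕ)) i.2.1 1).toReal)) =
      σ * s * ((N / 2 : ℕ) * (averagedPart d k part - testMean H ψ (M * (k : ℕ)) part)) := by
    have := sum_ite_testIndex k part (fun i : TestIndex K N => σ * s * ((-1 : ℝ) ^ (d i : ℕ) -
      testMean H ψ (M * (i.1 : ℕ)) i.2.1))
    rw [← Finset.mul_sum, Finset.sum_sub_distrib] at this
    simp only [Finset.sum_const, Finset.card_univ, Fintype.card_fin, nsmul_eq_mul] at this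
    rw [averagedPart, mul_sub, mul_div_cancel₀ _ hN'.ne', ← this]
    refine Finset.sum_congr rfl fun i _ => ?_
    rw [ha, testMean]
    split_ifs <;> simp_all
  rw [h2]
  have := mul_le_mul_of_nonneg_left hd (mul_nonneg hN'.le hs)
  linarith

/-- Union bound over `K + 1` frequencies, two parts and two tails. -/
theorem roundLaw_toOuterMeasure_not_isAccurate_le (H : selfAdjoint (E →L[ℂ] E))
    (ψ : Metric.sphere (0 : E) 1) (M : ℝ) {s : ℝ} (hs : 0 ≤ s) (hN : 0 < N / 2) :
    (roundLaw H ψ K N M).toOuterMeasure {d | ¬ IsAccurate H ψ s M d} ≤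
      ENNReal.ofReal (4 * (K + 1) * Real.exp (-((N / 2 : ℕ) * s ^ 2 / 2))) := by
  set B : Fin (K + 1) → Fin 2 → Fin 2 → Set (RoundData K N) := fun k part b =>
    {d | s ≤ (-1 : ℝ) ^ (b : ℕ) * (averagedPart d k part - testMean H ψ (M * (k : ℕ)) part)} with hB
  have hsub : {d | ¬ IsAccurate H ψ s M d} ⊆ ⋃ k, ⋃ part, ⋃ b, B k part b := by
    intro d hd
    rw [mem_ofPred_eq, IsAccurate] at hd
    push Not at hd
    obtain ⟨k, part, h⟩ := hd
    refine mem_iUnion.mpr ⟨k, mem_iUnion.mpr ⟨part, mem_iUnion.mpr ?_⟩⟩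
    rcases lt_abs.mp h with h | h
    · refine ⟨0, ?_⟩
      simp only [hB, mem_ofPred_eq]
      simpa using h.le
    · refine ⟨1, ?_⟩
      simp only [hB, mem_ofPred_eq]
      simpa using h.le
  calc _ ≤ (roundLaw H ψ K N M).toOuterMeasure (⋃ k, ⋃ part, ⋃ b, B k part b) :=
        MeasureTheory.measure_mono hsub
    _ ≤ ∑ k : Fin (K + 1), ∑ part : Fin 2, ∑ b : Fin 2,
          (roundLaw H ψ K N M).toOuterMeasure (B k part b) :=
        (MeasureTheory.measure_iUnion_fintype_le _ _).trans (Finset.sum_le_sum fun k _ =>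
          (MeasureTheory.measure_iUnion_fintype_le _ _).trans (Finset.sum_le_sum fun part _ =>
            MeasureTheory.measure_iUnion_fintype_le _ _))
    _ ≤ ∑ _k : Fin (K + 1), ∑ _part : Fin 2, ∑ _b : Fin 2,
          ENNReal.ofReal (Real.exp (-((N / 2 : ℕ) * s ^ 2 / 2))) := by
        gcongr with k _ part _ b _
        exact roundLaw_toOuterMeasure_le H ψ M hs (by fin_cases b <;> simp) k part hN
    _ = _ := by
        simp only [Finset.sum_const, Finset.card_univ, Fintype.card_fin, nsmul_eq_mul]
        rw [ENNReal.ofReal_mul (by positivity), ENNReal.ofReal_mul (by positivity)]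
        rw [show (K + 1 : ℝ) = ((K + 1 : ℕ) : ℝ) by push_cast; rfl, ENNReal.ofReal_natCast,
          ENNReal.ofReal_ofNat]
        push_cast
        ring

end Concentration

end

noncomputable section

/-! ### Histories of the algorithm -/

section Runs

variable {K N : ℕ} {β ω η ε : ℝ} {rule : History K N → ℝ}

theorem two_pow_length_le_amplification (hrule : AdmissibleRule β ω η rule) (h : History K N) :
    (2 : ℝ) ^ h.length ≤ amplification rule h := by
  induction h with
  | nil => simp [amplification]
  | cons d h ih =>
    rw [amplification, List.length_cons, pow_succ]
    exact mul_le_mul ih (hrule d h).1.1 (by norm_num) ((by positivity : (0 : ℝ) ≤ 2 ^ h.length).trans ih)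

theorem amplification_pos (hrule : AdmissibleRule β ω η rule) (h : History K N) :
    0 < amplification rule h :=
  (by positivity : (0 : ℝ) < 2 ^ h.length).trans_le (two_pow_length_le_amplification hrule h)

/-- A history that the loop can produce: no round was started after the loop had ended. -/
def Reachable (η ε : ℝ) (rule : History K N → ℝ) : History K N → Prop
  | [] => True
  | _ :: h => ¬ Halted η ε rule h ∧ Reachable η ε rule h

/-- If the loop has not ended, the preceding amplification was below `η / ε`, and one more factor is
at most `4`. -/
theorem amplification_le_of_not_halted (hrule : AdmissibleRule β ω η rule) (hε : 0 < ε)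
    (hεη : ε ≤ η) {h : History K N} (hh : ¬ Halted η ε rule h) :
    amplification rule h ≤ 4 * (η / ε) := by
  have h1 : 1 ≤ η / ε := by rwa [one_le_div hε]
  cases h with
  | nil => rw [amplification]; linarith
  | cons d h =>
    have hpos := amplification_pos hrule h
    rw [Halted, not_le, lt_div_iff₀ hpos] at hh
    have h2 : amplification rule h ≤ η / ε := by
      rw [le_div_iff₀ hε]; linarith
    rw [amplification]
    have := mul_le_mul h2 (hrule d h).1.2 (by linarith [(hrule d h).1.1]) (by linarith)
    linarith

theorem maxRuntime_le (hrule : AdmissibleRule β ω η rule) (hε : 0 < ε) (hεη : ε ≤ η)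
    {h : History K N} (hh : Reachable η ε rule h) :
    maxRuntime rule h ≤ 4 * (η * K / ε) := by
  have h0 : 0 ≤ 4 * (η * K / ε) := by
    have : 0 < η := hε.trans_le hεη
    positivity
  induction h with
  | nil => exact h0
  | cons d h ih =>
    rw [maxRuntime]
    refine max_le (ih hh.2) (Real.iSup_le (fun i => ?_) h0)
    have hi : ((i.1 : ℕ) : ℝ) ≤ K := by exact_mod_cast Nat.lt_succ_iff.mp i.1.2
    calc _ ≤ 4 * (η / ε) * K :=
          mul_le_mul (amplification_le_of_not_halted hrule hε hεη hh.1) hi (by positivity)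
            (by have : 0 < η := hε.trans_le hεη
                positivity)
      _ = _ := by ring

theorem sum_testIndex_le {M : ℝ} (hM : 0 ≤ M) :
    ∑ i : TestIndex K N, M * ((i.1 : ℕ) : ℝ) ≤ M * (2 * (K : ℝ) ^ 2 * N) := by
  calc _ ≤ ∑ _i : TestIndex K N, M * (K : ℝ) := by
        gcongr with i
        exact Nat.lt_succ_iff.mp i.1.2
    _ = M * (((K + 1) * K : ℕ) * (2 * (N / 2) : ℕ)) := by
        rw [Finset.sum_const, Finset.card_univ, nsmul_eq_mul]
        simp only [Fintype.card_prod, Fintype.card_fin]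
        push_cast
        ring
    _ ≤ M * ((2 * K ^ 2 : ℕ) * (N : ℕ)) := by
        refine mul_le_mul_of_nonneg_left (mul_le_mul (Nat.cast_le.mpr ?_)
          (Nat.cast_le.mpr (Nat.mul_div_le N 2)) (by positivity) (by positivity)) hM
        nlinarith [Nat.le_self_pow two_ne_zero K]
    _ = _ := by push_cast; ring

/-- Amplifications at least double, so the sum over all rounds is at most twice the last bound. -/
theorem totalRuntime_cons_le (hrule : AdmissibleRule β ω η rule) (d : RoundData K N)
    (h : History K N) :
    totalRuntime rule (d :: h) ≤ 2 * amplification rule h * (2 * (K : ℝ) ^ 2 * N) := by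
  induction h generalizing d with
  | nil =>
    have := sum_testIndex_le (K := K) (N := N) zero_le_one
    simp only [totalRuntime, amplification, zero_add]
    refine this.trans ?_
    gcongr
    norm_num
  | cons d' h ih =>
    rw [totalRuntime]
    have h1 := sum_testIndex_le (K := K) (N := N) (amplification_pos hrule (d' :: h)).le
    have h2 : 2 * amplification rule h ≤ amplification rule (d' :: h) := by
      rw [amplification, mul_comm]
      exact mul_le_mul_of_nonneg_left (hrule d' h).1.1 (amplification_pos hrule h).le
    have h3 := mul_le_mul_of_nonneg_right h2 (by positivity : 0 ≤ 2 * (K : ℝ) ^ 2 * N)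
    linarith [ih d']

theorem totalRuntime_le (hrule : AdmissibleRule β ω η rule) (hε : 0 < ε) (hεη : ε ≤ η)
    {h : History K N} (hh : Reachable η ε rule h) :
    totalRuntime rule h ≤ 16 * (η * (K : ℝ) ^ 2 * N / ε) := by
  have hη : 0 < η := hε.trans_le hεη
  cases h with
  | nil => rw [totalRuntime]; positivity
  | cons d h =>
    refine (totalRuntime_cons_le hrule d h).trans ?_
    have := mul_le_mul_of_nonneg_right (amplification_le_of_not_halted hrule hε hεη hh.1)
      (by positivity : 0 ≤ 4 * ((K : ℝ) ^ 2 * N))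
    calc _ = amplification rule h * (4 * ((K : ℝ) ^ 2 * N)) := by ring
      _ ≤ _ := this
      _ = _ := by ring

/-- Rounds are counted from `0`: the last of `R + 1` rounds runs at amplification at least `2 ^ R`,
and `2 ^ R ≥ η / ε` for `R = ⌈log₂ (η / ε)⌉`. -/
theorem halted_of_le_length (hrule : AdmissibleRule β ω η rule) (hε : 0 < ε) (hεη : ε ≤ η)
    {h : History K N} (hh : ⌈Real.logb 2 (η / ε)⌉₊ + 1 ≤ h.length) : Halted η ε rule h := by
  have hη : 0 < η := hε.trans_le hεη
  cases h with
  | nil => simp at hh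
  | cons d h =>
    rw [List.length_cons, Nat.add_le_add_iff_right] at hh
    rw [Halted, div_le_iff₀ (amplification_pos hrule h), mul_comm, ← div_le_iff₀ hε]
    refine le_trans ?_ (two_pow_length_le_amplification hrule h)
    rw [← Real.rpow_natCast, ← Real.logb_le_iff_le_rpow (by norm_num) (by positivity)]
    exact (Nat.le_ceil _).trans (by exact_mod_cast hh)

variable {E : Type*} [NormedAddCommGroup E] [InnerProductSpace ℂ E] [CompleteSpace E]
  {H : selfAdjoint (E →L[ℂ] E)} {ψ : Metric.sphere (0 : E) 1}

theorem reachable_of_mem_support_runLaw {n : ℕ} {h : History K N}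
    (hh : h ∈ (runLaw H ψ η ε rule n).support) :
    Reachable η ε rule h ∧ (Halted η ε rule h ∨ h.length = n) := by
  induction n generalizing h with
  | zero =>
    rw [runLaw, PMF.mem_support_pure_iff] at hh
    subst hh
    exact ⟨trivial, Or.inr rfl⟩
  | succ n ih =>
    rw [runLaw, PMF.mem_support_bind_iff] at hh
    obtain ⟨g, hg, hgh⟩ := hh
    rw [loopStep] at hgh
    split_ifs at hgh with hhalt
    · rw [PMF.mem_support_pure_iff] at hgh
      subst hgh
      exact ⟨(ih hg).1, Or.inl hhalt⟩
    · obtain ⟨d, -, rfl⟩ := (PMF.mem_support_map_iff _ _ _).mp hgh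
      refine ⟨⟨hhalt, (ih hg).1⟩, Or.inr ?_⟩
      rw [List.length_cons, (ih hg).2.resolve_left hhalt]

theorem halted_of_mem_support_runLaw (hrule : AdmissibleRule β ω η rule) (hε : 0 < ε)
    (hεη : ε ≤ η) {n : ℕ} (hn : ⌈Real.logb 2 (η / ε)⌉₊ + 1 ≤ n) {h : History K N}
    (hh : h ∈ (runLaw H ψ η ε rule n).support) : Halted η ε rule h := by
  rcases (reachable_of_mem_support_runLaw hh).2 with h1 | h1
  · exact h1
  · exact halted_of_le_length hrule hε hεη (h1 ▸ hn)

theorem runLaw_eq_of_le (hrule : AdmissibleRule β ω η rule) (hε : 0 < ε) (hεη : ε ≤ η) {n : ℕ}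
    (hn : ⌈Real.logb 2 (η / ε)⌉₊ + 1 ≤ n) :
    runLaw H ψ η ε rule n = runLaw H ψ η ε rule (⌈Real.logb 2 (η / ε)⌉₊ + 1) := by
  induction n, hn using Nat.le_induction with
  | base => rfl
  | succ n hn ih =>
    rw [← ih, runLaw]
    conv_rhs => rw [← PMF.bind_pure (runLaw H ψ η ε rule n)]
    ext h
    rw [PMF.bind_apply, PMF.bind_apply]
    refine tsum_congr fun g => ?_
    by_cases hg : g ∈ (runLaw H ψ η ε rule n).support
    · rw [loopStep, if_pos (halted_of_mem_support_runLaw hrule hε hεη hn hg)]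
    · rw [PMF.mem_support_iff, not_not] at hg
      rw [hg, zero_mul, zero_mul]

/-- All averages measured in all rounds are within `s` of their means. -/
def AccurateHistory (H : selfAdjoint (E →L[ℂ] E)) (ψ : Metric.sphere (0 : E) 1) (s : ℝ)
    (rule : History K N → ℝ) : History K N → Prop
  | [] => True
  | d :: h => AccurateHistory H ψ s rule h ∧ IsAccurate H ψ s (amplification rule h) d

/-- The bound `δ` holds for every `M`, so it applies however `M` depends on the past. -/
theorem loopStep_toOuterMeasure_le {s : ℝ} {δ : ℝ≥0∞}
    (hδ : ∀ M, (roundLaw H ψ K N M).toOuterMeasure {d | ¬ IsAccurate H ψ s M d} ≤ δ)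
    {h : History K N} (hh : AccurateHistory H ψ s rule h) :
    (loopStep H ψ η ε rule h).toOuterMeasure {g | ¬ AccurateHistory H ψ s rule g} ≤ δ := by
  rw [loopStep]
  split_ifs
  · rw [PMF.toOuterMeasure_pure_apply, if_neg (by simpa using hh)]
    exact zero_le
  · rw [PMF.toOuterMeasure_map_apply]
    refine le_trans (MeasureTheory.measure_mono fun d hd => ?_) (hδ (amplification rule h))
    rw [mem_preimage, mem_ofPred_eq, AccurateHistory] at hd
    exact fun h' => hd ⟨hh, h'⟩

theorem runLaw_toOuterMeasure_le {s : ℝ} {δ : ℝ≥0∞}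
    (hδ : ∀ M, (roundLaw H ψ K N M).toOuterMeasure {d | ¬ IsAccurate H ψ s M d} ≤ δ) (n : ℕ) :
    (runLaw H ψ η ε rule n).toOuterMeasure {h | ¬ AccurateHistory H ψ s rule h} ≤ n * δ := by
  induction n with
  | zero =>
    rw [runLaw, PMF.toOuterMeasure_pure_apply, if_neg (by simp [AccurateHistory])]
    exact zero_le
  | succ n ih =>
    rw [runLaw, PMF.toOuterMeasure_bind_apply]
    set P := runLaw H ψ η ε rule n with hP
    -- A history is inaccurate either already, at cost `P h`, or through the new round, at cost `P h
    -- * δ`.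
    have hle : ∀ h, P h * (loopStep H ψ η ε rule h).toOuterMeasure
        {g | ¬ AccurateHistory H ψ s rule g} ≤
        {h | ¬ AccurateHistory H ψ s rule h}.indicator P h + P h * δ := by
      intro h
      by_cases hh : AccurateHistory H ψ s rule h
      · exact (mul_le_mul_right (loopStep_toOuterMeasure_le hδ hh) _).trans le_add_self
      · rw [indicator_of_mem (by exact hh)]
        exact (mul_le_of_le_one_right zero_le
          (((loopStep H ψ η ε rule h).toOuterMeasure.mono (subset_univ _)).trans
            (PMF.toOuterMeasure_apply_eq_one_iff _ _ |>.mpr (subset_univ _)).le)).trans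
          le_self_add
    refine (ENNReal.tsum_le_tsum hle).trans ?_
    rw [ENNReal.tsum_add, ENNReal.tsum_mul_right, P.tsum_coe, one_mul, ← PMF.toOuterMeasure_apply,
      Nat.cast_succ, add_mul, one_mul]
    exact add_le_add_left ih δ

end Runs

end

noncomputable section

/-! ### Correctness of an accurate run -/

section Correctness

theorem not_mem_of_separates {S : ℕ} {lam : Fin S → ℝ} {η M m : ℝ} {F : Set ℝ}
    (hsep : Separates η M F m) (hlam : ∀ i, lam i ∈ F) {z : ℝ} {i : Fin S}
    (hz : |z - lam i| ≤ η / (2 * M)) {q : ℤ} (hq : q ≠ 0) : z + q / (M * m) ∉ F := by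
  intro hF
  rw [abs_le] at hz
  have : z + q / (M * m) ∈ translateSet (nbhd F (η / (2 * M))) (q / (M * m)) ∩ F :=
    ⟨⟨z, mem_biUnion (hlam i) ⟨by linarith [hz.1], by linarith [hz.2]⟩, rfl⟩, hF⟩
  rw [hsep q hq] at this
  exact this

/-- The frequencies are separated modulo `1`, because they lie in `[0, 0.9]`. -/
theorem le_abs_add_intCast_sub {S : ℕ} (hS : 1 ≤ S) {lam : Fin S → ℝ}
    (hlam : ∀ s, lam s ∈ Icc (0 : ℝ) (9 / 10)) {η : ℝ} (hη : η ≤ 1 / (8 * S * (2 * S - 1)))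
    (i j : Fin S) {q : ℤ} (hq : q ≠ 0) : η ≤ |lam i + q - lam j| := by
  have hS1 : (1 : ℝ) ≤ S := by exact_mod_cast hS
  rw [le_div_iff₀ (by nlinarith)] at hη
  -- For `S = 1` only `η ≤ 1/8` is known, which exceeds the gap `1/10` left by `[0, 0.9]` modulo
  -- `1`; but then the indices agree and the distance is `|q| ≥ 1`.
  by_cases hij : i = j
  · subst hij
    rw [add_sub_cancel_left]
    have : (1 : ℝ) ≤ |(q : ℝ)| := by exact_mod_cast Int.one_le_abs hq
    have h8 : (8 : ℝ) ≤ 8 * S * (2 * S - 1) := by nlinarith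
    nlinarith
  · have hS2 : 2 ≤ S := by
      by_contra h
      exact hij (Fin.ext (by omega))
    have hS2' : (2 : ℝ) ≤ S := by exact_mod_cast hS2
    have h6 : (6 : ℝ) ≤ S * (2 * S - 1) := by nlinarith
    have hη' : η ≤ 1 / 48 := by
      by_contra h
      nlinarith
    obtain ⟨hi0, hi1⟩ := hlam i
    obtain ⟨hj0, hj1⟩ := hlam j
    rcases lt_or_gt_of_ne hq with h | h
    · have : (q : ℝ) ≤ -1 := by exact_mod_cast Int.le_sub_one_of_lt h
      rw [abs_of_nonpos (by linarith)]
      linarith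
    · have : (1 : ℝ) ≤ q := by exact_mod_cast h
      rw [abs_of_nonneg (by linarith)]
      linarith

variable {E : Type*} [NormedAddCommGroup E] [InnerProductSpace ℂ E] [CompleteSpace E] {K N : ℕ}
  {β ω α η ε : ℝ} {rule : History K N → ℝ}
  {H : selfAdjoint (E →L[ℂ] E)} {ψ : Metric.sphere (0 : E) 1}
  {κ : Type*} [Fintype κ] {S : ℕ} {lam p : Fin S → ℝ} {w μ : κ → ℝ}

theorem accurate_round
    (hψ : ∀ t : ℝ, inner ℂ (ψ : E) (evolution H t ψ) =
        ∑ s, (p s : ℂ) * Complex.exp (-(2 * Real.pi * Complex.I * t * lam s)) +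
        ∑ j, (w j : ℂ) * Complex.exp (-(2 * Real.pi * Complex.I * t * μ j)))
    (hω : 0 ≤ ω) (hp : ∀ i, β ≤ p i) (hw : ∀ j, 0 ≤ w j) (hpw : ∑ i, p i + ∑ j, w j ≤ 1)
    (hwω : ∑ j, w j ≤ ω) (h : ω < β) (h1 : β - ω ≤ 1) (hK : 3 * tau β ω ≤ K) (hα : 0 ≤ α)
    (hα3 : α < (β - ω) / 3) {M : ℝ} {d : RoundData K N}
    (hd : IsAccurate H ψ (α / Real.sqrt 2) M d) :
    (∀ x ∈ closure (superlevelSet β ω d), ∃ i, ∃ n : ℤ, |x - (M * lam i + n)| < tau β ω / K) ∧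
      ∀ i, ∀ n : ℤ, M * lam i + n ∈ superlevelSet β ω d := by
  have hK0 : 0 < K := by
    have : (0 : ℝ) < K := by linarith [tau_pos h h1]
    exact_mod_cast this
  constructor
  · intro x hx
    by_contra! hfar
    exact absurd (closure_superlevelSet_subset d hx) (not_le.mpr (norm_filteredSignal_lt
      (fun i => by linarith [hp i]) hw hpw hwω h h1 hK hα hα3
      (fun k hk => norm_signal_sub_le hψ hα hd hk) hfar))
  · intro i n
    rw [superlevelSet_eq]
    exact lt_norm_filteredSignal hω hp hw hpw h h1 hK0 hα hα3
      (fun k hk => norm_signal_sub_le hψ hα hd hk) i n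

/-- The amplification at which the last data of a history were measured. -/
def lastAmplification (rule : History K N → ℝ) : History K N → ℝ
  | [] => 1
  | _ :: h => amplification rule h

/-- Closeness of the estimate to the frequencies yields a separating factor; separation makes the
next shifts unique; and uniqueness gives closeness at the next scale. The closeness clause excludes
the empty history, whose estimate is all of `[0, 0.9]`. -/
theorem properRun_of_accurateHistory (hS : 1 ≤ S) (hlam : ∀ s, lam s ∈ Icc (0 : ℝ) (9 / 10))
    (hψ : ∀ t : ℝ, inner ℂ (ψ : E) (evolution H t ψ) =
        ∑ s, (p s : ℂ) * Complex.exp (-(2 * Real.pi * Complex.I * t * lam s)) +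
        ∑ j, (w j : ℂ) * Complex.exp (-(2 * Real.pi * Complex.I * t * μ j)))
    (hω : 0 ≤ ω) (hp : ∀ i, β ≤ p i) (hw : ∀ j, 0 ≤ w j) (hpw : ∑ i, p i + ∑ j, w j ≤ 1)
    (hwω : ∑ j, w j ≤ ω) (h : ω < β) (h1 : β - ω ≤ 1) (hα : 0 ≤ α)
    (hα3 : α < (β - ω) / 3) (hη0 : 0 < η) (hη : η ≤ 1 / (8 * S * (2 * S - 1)))
    (hK : 3 * η⁻¹ * tau β ω ≤ K) (hrule : AdmissibleRule β ω η rule) {g : History K N}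
    (hg : AccurateHistory H ψ (α / Real.sqrt 2) rule g) :
    ProperRun β ω η rule g ∧ (∀ i, lam i ∈ estimate β ω rule g) ∧
      (g ≠ [] → ∀ z ∈ estimate β ω rule g, ∃ i,
        |z - lam i| ≤ η / (2 * lastAmplification rule g)) := by
  have hS1 : (1 : ℝ) ≤ S := by exact_mod_cast hS
  have hη8 : η ≤ 1 / 8 := by
    refine hη.trans (one_div_le_one_div_of_le (by norm_num) ?_)
    nlinarith
  have hτ := tau_pos h h1
  have hτη : 3 * tau β ω ≤ K * η := by
    have := mul_le_mul_of_nonneg_right hK hη0.le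
    have e : 3 * η⁻¹ * tau β ω * η = 3 * tau β ω := by field_simp
    linarith
  have hK0 : (0 : ℝ) < K := by
    by_contra hneg
    nlinarith
  have hδ : 3 * (tau β ω / K) ≤ η := by
    rw [← mul_div_assoc, div_le_iff₀ hK0]
    linarith
  have hK3 : 3 * tau β ω ≤ K := by nlinarith
  induction g with
  | nil =>
    exact ⟨trivial, hlam, fun h => absurd rfl h⟩
  | cons d g ih =>
    obtain ⟨ihP, ihlam, ihnear⟩ := ih hg.1
    obtain ⟨hX, hmem⟩ := accurate_round hψ hω hp hw hpw hwω h h1 hK3 hα hα3 hg.2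
    have hM := amplification_pos hrule g
    have hfac : FactorSeparates β ω η rule g := by
      cases g with
      | nil => trivial
      | cons d' g =>
        exact (hrule d' g).2 (exists_separates hS lam hη0 hη (amplification_pos hrule g)
          (ihnear (List.cons_ne_nil _ _)))
    have hr : 3 / 2 * (tau β ω / K) / amplification rule g ≤ η / (2 * amplification rule g) := by
      rw [div_le_div_iff₀ hM (by positivity)]
      nlinarith
    -- In round `0` the gap of `[0, 0.9]` modulo `1` prevents aliasing; afterwards the separation
    -- condition of the chosen factor does.
    have hnext : (∀ i j, ∀ q : ℤ, q ≠ 0 → 3 * (tau β ω / K) / amplification rule g ≤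
          |lam i + q / amplification rule g - lam j|) ∧
        ∀ z i, |z - lam i| < 3 / 2 * (tau β ω / K) / amplification rule g →
          ∀ q : ℤ, q ≠ 0 → z + q / amplification rule g ∉ estimate β ω rule g := by
      cases g with
      | nil =>
        simp only [amplification, div_one, estimate]
        refine ⟨fun i j q hq => hδ.trans (le_abs_add_intCast_sub hS hlam hη i j hq),
          fun z i hz q hq hF => ?_⟩
        rw [abs_lt] at hz
        obtain ⟨hi0, hi1⟩ := hlam i
        rcases lt_or_gt_of_ne hq with hq | hq
        · have : (q : ℝ) ≤ -1 := by exact_mod_cast Int.le_sub_one_of_lt hq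
          linarith [hz.2, hF.1]
        · have : (1 : ℝ) ≤ q := by exact_mod_cast hq
          linarith [hz.1, hF.2]
      | cons d' g =>
        have hM' := amplification_pos hrule g
        have hm := (hrule d' g).1.1
        -- This uses `m ≥ 2`: the new resolution fits into the neighbourhood fixed at the old scale.
        have hle : η / amplification rule (d' :: g) ≤ η / (2 * amplification rule g) := by
          rw [amplification]
          gcongr η / ?_
          nlinarith
        constructor
        · intro i j q hq
          -- Otherwise `lam j` minus the shift would lie in the neighbourhood of `lam i`, and
          -- shifting it back gives `lam j`, a point of the estimate.
          by_contra! hlt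
          have hz : |(lam j - q / (amplification rule g * rule (d' :: g))) - lam i| ≤
              η / (2 * amplification rule g) := by
            rw [abs_sub_comm, ← sub_add, sub_add_eq_add_sub]
            refine le_trans hlt.le (le_trans ?_ hle)
            gcongr
          have := not_mem_of_separates hfac ihlam hz hq
          rw [sub_add_cancel] at this
          exact this (ihlam j)
        · intro z i hz q hq
          refine not_mem_of_separates hfac ihlam (hz.le.trans (hr.trans (le_trans ?_ hle))) hq
          gcongr
          linarith
    obtain ⟨hu, hl, hn⟩ := uniqueShifts_and_updateEstimate hM hX hmem hnext.1 hnext.2 ihlam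
    refine ⟨⟨ihP, hfac, hu⟩, hl, fun _ z hz => ?_⟩
    obtain ⟨i, hi⟩ := hn z hz
    exact ⟨i, hi.le.trans hr⟩

theorem estimate_subset_nbhd_of_halted {g : History K N} (hη0 : 0 < η)
    (hrule : AdmissibleRule β ω η rule) (hhalt : Halted η ε rule g)
    (hnear : g ≠ [] → ∀ z ∈ estimate β ω rule g, ∃ i,
        |z - lam i| ≤ η / (2 * lastAmplification rule g)) :
    estimate β ω rule g ⊆ nbhd (range lam) ε := by
  cases g with
  | nil => exact hhalt.elim
  | cons d g =>
    intro z hz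
    obtain ⟨i, hi⟩ := hnear (List.cons_ne_nil _ _) z hz
    have hM := amplification_pos hrule g
    have hle : η / (2 * amplification rule g) ≤ η / amplification rule g := by
      gcongr η / ?_
      linarith
    have := hi.trans (hle.trans hhalt)
    rw [abs_le] at this
    exact mem_biUnion (mem_range_self i) ⟨by linarith [this.1], by linarith [this.2]⟩

end Correctness

/-- The choice of `N` makes the Hoeffding exponent `(N / 2) * α² / 4` at least the sum of
logarithms, and `4 (K + 1)` times the resulting exponential is `ρ / R`. -/
theorem roundLaw_toOuterMeasure_not_isAccurate_le_div {E : Type*} [NormedAddCommGroup E]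
    [InnerProductSpace ℂ E] [CompleteSpace E] (H : selfAdjoint (E →L[ℂ] E))
    (ψ : Metric.sphere (0 : E) 1) (M : ℝ) {α ρ R : ℝ} {K N : ℕ} (hα : 0 < α) (hρ : 0 < ρ)
    (hρ1 : ρ < 1) (hR : 1 ≤ R)
    (hN : N = 2 * ⌈4 / α ^ 2 * (Real.log (4 / ρ) + Real.log R + Real.log ((K : ℝ) + 1))⌉₊) :
    (roundLaw H ψ K N M).toOuterMeasure {d | ¬ IsAccurate H ψ (α / Real.sqrt 2) M d} ≤
      ENNReal.ofReal (ρ / R) := by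
  set l := Real.log (4 / ρ) + Real.log R + Real.log ((K : ℝ) + 1) with hl
  have hK1 : (1 : ℝ) ≤ (K : ℝ) + 1 := by linarith [Nat.cast_nonneg (α := ℝ) K]
  have h4 : 1 < 4 / ρ := by rw [lt_div_iff₀ hρ]; linarith
  have hl0 : 0 < l := by
    have := Real.log_pos h4
    have := Real.log_nonneg hR
    have := Real.log_nonneg hK1
    linarith
  have hN2 : N / 2 = ⌈4 / α ^ 2 * l⌉₊ := by omega
  have hNpos : 0 < N / 2 := by
    rw [hN2, Nat.ceil_pos]
    positivity
  refine (roundLaw_toOuterMeasure_not_isAccurate_le H ψ M (by positivity) hNpos).trans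
    (ENNReal.ofReal_le_ofReal ?_)
  have hle : l ≤ (N / 2 : ℕ) * (α / Real.sqrt 2) ^ 2 / 2 := by
    have h1 : 4 / α ^ 2 * l ≤ (N / 2 : ℕ) := hN2 ▸ Nat.le_ceil _
    rw [div_pow, Real.sq_sqrt (by norm_num)]
    have := mul_le_mul_of_nonneg_right h1 (by positivity : 0 ≤ α ^ 2 / 4)
    have e : 4 / α ^ 2 * l * (α ^ 2 / 4) = l := by field_simp
    linarith
  have hexp : Real.exp (-l) = ρ / (4 * R * (K + 1)) := by
    rw [hl, Real.exp_neg, Real.exp_add, Real.exp_add, Real.exp_log (by positivity),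
      Real.exp_log (by positivity), Real.exp_log (by positivity)]
    field_simp
  calc _ ≤ 4 * (K + 1) * Real.exp (-l) := by gcongr
    _ = ρ / R := by
      rw [hexp]
      field_simp

end

/-! ### Assembly of the theorem -/

theorem mainTheorem1 :
    ∃ C : ℝ, 0 < C ∧
      ∀ {E : Type*} [NormedAddCommGroup E] [InnerProductSpace ℂ E] [FiniteDimensional ℂ E]
        [CompleteSpace E]
        -- the Hamiltonian and the input state
        (H : selfAdjoint (E →L[ℂ] E)) (ψ : Metric.sphere (0 : E) 1)
        -- dominant eigenpairs, their overlaps with the input state, and the residual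
        (S : ℕ) (_ : 1 ≤ S) (lam : Fin S → ℝ) (v : Fin S → E) (c : Fin S → ℂ) (r : E)
        (_ : Orthonormal ℂ v)
        (_ : ∀ s, (H : E →L[ℂ] E) (v s) = (lam s : ℂ) • v s)
        (_ : ∀ s, inner ℂ (v s) r = 0)
        (_ : (ψ : E) = (∑ s, c s • v s) + r)
        (_ : ∀ s, lam s ∈ Set.Icc (0 : ℝ) (9 / 10))
        -- the parameters
        (β ω α η ε ρ : ℝ) (K N : ℕ)
        (_ : ∀ s, β ≤ ‖c s‖ ^ 2) (_ : ‖r‖ ^ 2 ≤ ω) (_ : ω < β)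
        (_ : 0 < α) (_ : α < (β - ω) / 3)
        (_ : 0 < η) (_ : η ≤ 1 / (8 * S * (2 * S - 1)))
        (_ : 3 * η⁻¹ * tau β ω ≤ K)
        (_ : 0 < ε) (_ : ε ≤ η) (_ : 0 < ρ) (_ : ρ < 1)
        (_ : N = 2 * ⌈4 / α ^ 2 * (Real.log (4 / ρ)
          + Real.log ((⌈Real.logb 2 (η / ε)⌉₊ : ℝ) + 1) + Real.log ((K : ℝ) + 1))⌉₊)
        (rule : History K N → ℝ) (_ : AdmissibleRule β ω η rule)
        -- the number of passes through the loop
        (n : ℕ) (_ : ⌈Real.logb 2 (η / ε)⌉₊ + 1 ≤ n),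
        (∀ h ∈ (runLaw H ψ η ε rule n).support,
          Halted η ε rule h ∧
          maxRuntime rule h ≤ C * (η * K / ε) ∧
          totalRuntime rule h ≤ C * (η * (K : ℝ) ^ 2 * N / ε)) ∧
        ENNReal.ofReal (1 - ρ) ≤ (runLaw H ψ η ε rule n).toOuterMeasure
          {h | ProperRun β ω η rule h ∧ Set.range lam ⊆ estimate β ω rule h ∧
            estimate β ω rule h ⊆ nbhd (Set.range lam) ε} := by
  refine ⟨16, by norm_num, ?_⟩
  intro E _ _ _ _ H ψ S hS lam v c r hv hH hr hψ hlam β ω α η ε ρ K N hβ hω hωβ hα hα3 hη0 hη hK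
    hε hεη hρ hρ1 hN rule hrule n hn
  refine ⟨fun h hh => ?_, ?_⟩
  · have hreach := (reachable_of_mem_support_runLaw hh).1
    refine ⟨halted_of_mem_support_runLaw hrule hε hεη hn hh,
      (maxRuntime_le hrule hε hεη hreach).trans ?_, totalRuntime_le hrule hε hεη hreach⟩
    have : 0 ≤ η * K / ε := by positivity
    linarith
  obtain ⟨m, w, μ, hw, hwr, hinner⟩ := inner_evolution_eq H c hv hH hr
  rw [← hψ] at hinner
  have hω0 : 0 ≤ ω := (sq_nonneg _).trans hω
  -- Time `0` of the spectral formula gives the total mass.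
  have hpw : ∑ s, ‖c s‖ ^ 2 + ∑ j, w j = 1 := by
    have h0 := hinner 0
    rw [evolution_zero, inner_self_eq_norm_sq_to_K, norm_eq_of_mem_sphere, RCLike.ofReal_one,
      one_pow] at h0
    simp only [Complex.ofReal_zero, mul_zero, zero_mul, neg_zero, Complex.exp_zero, mul_one] at h0
    exact_mod_cast h0.symm
  have hβ1 : β - ω ≤ 1 := by
    have h1 := Finset.single_le_sum (f := fun s => ‖c s‖ ^ 2) (fun s _ => sq_nonneg _)
      (Finset.mem_univ (⟨0, hS⟩ : Fin S))
    have h2 : 0 ≤ ∑ j, w j := Finset.sum_nonneg fun j _ => hw j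
    have h3 := hβ ⟨0, hS⟩
    linarith
  -- Further passes change nothing, so the union bound needs only `R + 1` rounds, each failing with
  -- probability at most `ρ / (R + 1)`.
  rw [runLaw_eq_of_le hrule hε hεη hn]
  set R := ⌈Real.logb 2 (η / ε)⌉₊ with hR
  set P := runLaw H ψ η ε rule (R + 1) with hP
  set A : Set (History K N) := {h | AccurateHistory H ψ (α / Real.sqrt 2) rule h} with hA
  have hAc : P.toOuterMeasure Aᶜ ≤ ENNReal.ofReal ρ := by
    have h1 := runLaw_toOuterMeasure_le (η := η) (ε := ε) (rule := rule) (fun M =>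
      roundLaw_toOuterMeasure_not_isAccurate_le_div H ψ M hα hρ hρ1
        (by linarith [Nat.cast_nonneg (α := ℝ) R] : (1 : ℝ) ≤ (R : ℝ) + 1) hN) (R + 1)
    refine h1.trans (le_of_eq ?_)
    rw [← ENNReal.ofReal_natCast, ← ENNReal.ofReal_mul (by positivity)]
    congr 1
    push_cast
    field_simp
  have hle : ENNReal.ofReal (1 - ρ) ≤ P.toOuterMeasure A := by
    have h1 : 1 ≤ P.toOuterMeasure A + P.toOuterMeasure Aᶜ := by
      rw [← (PMF.toOuterMeasure_apply_eq_one_iff P univ).mpr (subset_univ _), ← union_compl_self A]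
      exact MeasureTheory.measure_union_le _ _
    rw [ENNReal.ofReal_sub _ hρ.le, ENNReal.ofReal_one]
    exact tsub_le_iff_right.mpr (h1.trans (by gcongr))
  -- The inclusion is only needed on the support, where the loop is known to have ended.
  refine hle.trans (PMF.toOuterMeasure_mono P ?_)
  rintro h ⟨hh, hsupp⟩
  have hhalt := halted_of_mem_support_runLaw hrule hε hεη le_rfl hsupp
  obtain ⟨h1, h2, h3⟩ := properRun_of_accurateHistory (w := w) (μ := μ) (p := fun s => ‖c s‖ ^ 2)
    hS hlam hinner hω0 hβ hw hpw.le (hwr.trans_le hω) hωβ hβ1 hα.le hα3 hη0 hη hK hrule hh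
  exact ⟨h1, range_subset_iff.mpr h2, estimate_subset_nbhd_of_halted hη0 hrule hhalt h3⟩
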